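/- **Setting.** Let $X(r,\theta)=(r\cos\theta,r\sin\theta)$, $\theta_0\in\mathbb R$, $r_*>0$, and let $r_1,r_2:[\theta_0,\infty)\to(0,\infty)$ be continuous with $$r_2(\theta+2\pi)<r_1(\theta)<r_2(\theta)\ \text{ for all }\theta\ge\theta_0,\qquad \lim_{\theta\to\infty}r_1(\theta)=\lim_{\theta\to\infty}r_2(\theta)=r_*.$$ Put $$U=\{X(r,\theta):\theta>\theta_0,\ r_1(\theta)<r<r_2(\theta)\},\qquad \widetilde U=\{X(r,\theta):\theta\ge\theta_0,\ r_1(\theta)\le r\le r_2(\theta)\},$$ $$\mathcal S_\theta=\{X(r,\theta): r_1(\theta)\le r\le r_2(\theta)\},\qquad \gamma=\{X(r_i(\theta),\theta):\theta\ge\theta_0,\ i=1,2\}.$$ Let $A=(a_{ij})$ be a function from $U$ to the symmetric real $2\times2$ matrices and $b:U\to\mathbb R^2$ such that, for some constants $c_0>0$, $M_1>0$, $M_2\ge0$, one has $\xi^{\rm T}A(x)\xi\ge c_0|\xi|^2$, ${\rm Tr}\,A(x)\le M_1$ and $|b(x)|\le M_2$ for all $x\in U$, $\xi\in\mathbb R^2$.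 Let $$Lu=-\sum_{i,j=1}^2a_{ij}\frac{\partial^2u}{\partial x_i\partial x_j}+b\cdot\nabla u .$$ Write $u^+=\max\{0,u\}$. A function $u:\widetilde U\to\mathbb R$ is *below exponential growth in $\widetilde U$* if $\lim_{\theta\to\infty}e^{-\varepsilon\theta}\sup_{x\in\mathcal S_\theta}|u(x)|=0$ for every $\varepsilon>0$. **Statement.** (1) There are constants $C_*>0$ and $\nu>0$ such that, for every $u\in C^2(U)\cap C(\widetilde U)$ that is below exponential growth in $\widetilde U$: (i) if $Lu\le0$ in $U$ and $u\le0$ on $\gamma$, then $$u^+(x)\le\max_{\mathcal S_{\theta_0}}u^+\ \text{ for all }x\in\widetilde U,\qquad \max_{\mathcal S_\theta}u^+\le C_*\Big(\max_{\mathcal S_{\theta_0}}u^+\Big)e^{-\nu(\theta-\theta_0)}\ \text{ for all }\theta\ge\theta_0;$$ (ii) if $Lu=0$ in $U$ and $u=0$ on $\gamma$, then $$|u(x)|\le\max_{\mathcal S_{\theta_0}}|u|\ \text{ for all }x\in\widetilde U,\qquad \max_{\mathcal S_\theta}|u|\le C_*\Big(\max_{\mathcal S_{\theta_0}}|u|\Big)e^{-\nu(\theta-\theta_0)}\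 \text{ for all }\theta\ge\theta_0.$$ (2) Assume in addition that $r_1,r_2$ are absolutely continuous on $[\theta_0,T]$ for every $T\ge\theta_0$ and that $r_1',r_2'\in L^\infty(\Theta,\infty)$ for some $\Theta\ge\theta_0$. For $\lambda\in[0,1]$ and $\theta\ge\theta_0$ let $X_\lambda(\theta)=X((1-\lambda)r_1(\theta)+\lambda r_2(\theta),\theta)$, and for $x\in\widetilde U$ let $$\mathscr L(x)=\int_{\theta_0}^{\theta}|X_\lambda'(\eta)|\,d\eta,$$ where $(\lambda,\theta)\in[0,1]\times[\theta_0,\infty)$ is the unique pair with $x=X_\lambda(\theta)$. Then there are constants $C_*'>0$ and $\nu'>0$ such that, for every $u\in C^2(U)\cap C(\widetilde U)$ that is below exponential growth in $\widetilde U$: (i) if $Lu\le0$ in $U$ and $u\le0$ on $\gamma$, then $$u^+(x)\le\max_{\mathcal S_{\theta_0}}u^+\quad\text{and}\quad u^+(x)\le C_*'\Big(\max_{\mathcal S_{\theta_0}}u^+\Big)e^{-\nu'\mathscr L(x)}\quad\text{for all }x\in\widetilde U;$$ (ii) if $Lu=0$ in $U$ and $u=0$ on $\gamma$, then $$|u(x)|\le\max_{\mathcal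 S_{\theta_0}}|u|\quad\text{and}\quad |u(x)|\le C_*'\Big(\max_{\mathcal S_{\theta_0}}|u|\Big)e^{-\nu'\mathscr L(x)}\quad\text{for all }x\in\widetilde U.$$ -/

import Mathlib

open Set Filter Topology MeasureTheory

noncomputable section

/-- The Euclidean plane. -/
abbrev Plane : Type := EuclideanSpace ℝ (Fin 2)

/-- The polar coordinates map `X(r, θ) = (r cos θ, r sin θ)`. -/
def polarX (r θ : ℝ) : Plane := !₂[r * Real.cos θ, r * Real.sin θ]

/-- The data of an infinitely winding planar domain: the inner and outer radii `r₁ < r₂` of the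
channel as functions of the winding angle `θ ∈ [θ₀, ∞)` (their values below `θ₀` play no role),
and the radius `rStar` of the limiting circle. -/
structure WindingDomain where
  θ₀ : ℝ
  r₁ : ℝ → ℝ
  r₂ : ℝ → ℝ
  rStar : ℝ
  continuousOn_r₁ : ContinuousOn r₁ (Ici θ₀)
  continuousOn_r₂ : ContinuousOn r₂ (Ici θ₀)
  r₁_pos : ∀ θ, θ₀ ≤ θ → 0 < r₁ θ
  r₂_pos : ∀ θ, θ₀ ≤ θ → 0 < r₂ θ
  r₁_lt_r₂ : ∀ θ, θ₀ ≤ θ → r₁ θ < r₂ θ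
  r₂_next_lt_r₁ : ∀ θ, θ₀ ≤ θ → r₂ (θ + 2 * Real.pi) < r₁ θ
  rStar_pos : 0 < rStar
  tendsto_r₁ : Tendsto r₁ atTop (𝓝 rStar)
  tendsto_r₂ : Tendsto r₂ atTop (𝓝 rStar)

namespace WindingDomain

variable (D : WindingDomain)

/-- The domain `U = {X(r, θ) : θ > θ₀, r₁(θ) < r < r₂(θ)}`. -/
def U : Set Plane :=
  {x | ∃ r θ : ℝ, D.θ₀ < θ ∧ D.r₁ θ < r ∧ r < D.r₂ θ ∧ x = polarX r θ}

/-- The set `Ũ = {X(r, θ) : θ ≥ θ₀, r₁(θ) ≤ r ≤ r₂(θ)}`. It consists of `U` and the part of the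
boundary of `U` outside the limiting circle. -/
def Utilde : Set Plane :=
  {x | ∃ r θ : ℝ, D.θ₀ ≤ θ ∧ D.r₁ θ ≤ r ∧ r ≤ D.r₂ θ ∧ x = polarX r θ}

/-- The lateral boundary `γ = γ₁ ∪ γ₂`, where `γᵢ` is the curve `r = rᵢ(θ)`, `θ ≥ θ₀`. -/
def lateral : Set Plane :=
  {x | ∃ θ : ℝ, D.θ₀ ≤ θ ∧ (x = polarX (D.r₁ θ) θ ∨ x = polarX (D.r₂ θ) θ)}

/-- The (closed) cross-section `S_θ` corresponding to the angle `θ`. -/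
def crossSection (θ : ℝ) : Set Plane :=
  {x | ∃ r : ℝ, D.r₁ θ ≤ r ∧ r ≤ D.r₂ θ ∧ x = polarX r θ}

/-- The maximum of `f` over the cross-section `S_θ`; it is attained as soon as `θ ≥ θ₀` and `f` is
continuous on `Ũ`, see `WindingDomain.isGreatest_crossMax`. -/
def crossMax (f : Plane → ℝ) (θ : ℝ) : ℝ := sSup (f '' D.crossSection θ)

theorem isGreatest_crossMax {f : Plane → ℝ} (hf : ContinuousOn f D.Utilde) {θ : ℝ}
    (hθ : D.θ₀ ≤ θ) : IsGreatest (f '' D.crossSection θ) (D.crossMax f θ) := by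
  have himg : D.crossSection θ = (fun r => polarX r θ) '' Icc (D.r₁ θ) (D.r₂ θ) := by
    ext x
    constructor
    · rintro ⟨r, h1, h2, rfl⟩
      exact ⟨r, ⟨h1, h2⟩, rfl⟩
    · rintro ⟨r, ⟨h1, h2⟩, rfl⟩
      exact ⟨r, h1, h2, rfl⟩
  have hc : IsCompact (D.crossSection θ) := by
    rw [himg]
    refine isCompact_Icc.image ?_
    unfold polarX
    refine (PiLp.continuous_toLp 2 _).comp (continuous_pi fun i => ?_)
    fin_cases i <;> simp <;> fun_prop
  have hsub : D.crossSection θ ⊆ D.Utilde := by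
    rintro x ⟨r, h1, h2, rfl⟩
    exact ⟨r, θ, hθ, h1, h2, rfl⟩
  have hne : (D.crossSection θ).Nonempty :=
    ⟨_, D.r₁ θ, le_rfl, (D.r₁_lt_r₂ θ hθ).le, rfl⟩
  exact (hc.image_of_continuousOn (hf.mono hsub)).isGreatest_sSup (hne.image f)

/-- A function on `Ũ` is below exponential growth if, for every `ε > 0`,
`e^{-εθ} sup_{S_θ} |f| → 0` as `θ → ∞`. (It is applied to functions that are continuous on `Ũ`,
whose suprema over the cross-sections are finite.) -/
def BelowExpGrowth (f : Plane → ℝ) : Prop :=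
  ∀ ε : ℝ, 0 < ε →
    Tendsto (fun θ => Real.exp (-ε * θ) * D.crossMax (fun x => |f x|) θ) atTop (𝓝 0)

/-- The radii are absolutely continuous (on every compact subinterval of `[θ₀, ∞)`) and have
essentially bounded derivatives on some half-line `(Θ, ∞)`, `Θ ≥ θ₀`. -/
def RegularRadii : Prop :=
  (∀ T, D.θ₀ ≤ T → AbsolutelyContinuousOnInterval D.r₁ D.θ₀ T ∧
    AbsolutelyContinuousOnInterval D.r₂ D.θ₀ T) ∧
  ∃ Θ, D.θ₀ ≤ Θ ∧ MemLp (deriv D.r₁) ⊤ (volume.restrict (Ioi Θ)) ∧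
    MemLp (deriv D.r₂) ⊤ (volume.restrict (Ioi Θ))

/-- The curve `X_l(θ) = X((1 - l) r₁(θ) + l r₂(θ), θ)`, `l ∈ [0, 1]`. -/
def midCurve (l θ : ℝ) : Plane := polarX ((1 - l) * D.r₁ θ + l * D.r₂ θ) θ

/-- The arc-length `s_l(θ) = ∫_{θ₀}^θ |X_l'(η)| dη` of the curve `X_l` over `[θ₀, θ]`. -/
def arcLength (l θ : ℝ) : ℝ := ∫ η in D.θ₀..θ, ‖deriv (D.midCurve l) η‖

open Classical in
/-- The arc-distance `ℒ(x)` of `x ∈ Ũ` from `S_{θ₀}` along the domain: `ℒ(x) = s_l(θ)` for the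
unique `(l, θ) ∈ [0, 1] × [θ₀, ∞)` with `x = X_l(θ)`, see `WindingDomain.arcDist_midCurve`
(and `0` off `Ũ`). -/
def arcDist (x : Plane) : ℝ :=
  if h : ∃ p : ℝ × ℝ, p.1 ∈ Icc (0 : ℝ) 1 ∧ D.θ₀ ≤ p.2 ∧ x = D.midCurve p.1 p.2 then
    D.arcLength h.choose.1 h.choose.2
  else 0

theorem r₂_lt_r₁_of_pos {θ : ℝ} (hθ : D.θ₀ ≤ θ) (n : ℕ) :
    D.r₂ (θ + (n + 1) * (2 * Real.pi)) < D.r₁ θ := by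
  induction n with
  | zero => simpa using D.r₂_next_lt_r₁ θ hθ
  | succ k ih =>
    have hp : D.θ₀ ≤ θ + ((k : ℝ) + 1) * (2 * Real.pi) := by
      have := Real.pi_pos
      nlinarith [mul_nonneg (by positivity : (0 : ℝ) ≤ (k : ℝ) + 1) Real.pi_pos.le]
    have h1 := D.r₂_next_lt_r₁ _ hp
    have h2 := D.r₁_lt_r₂ _ hp
    have e : θ + (((k + 1 : ℕ) : ℝ) + 1) * (2 * Real.pi)
        = θ + ((k : ℝ) + 1) * (2 * Real.pi) + 2 * Real.pi := by push_cast; ring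
    rw [e]
    linarith

/-- Polar coordinates are injective on the winding channel. -/
theorem polarX_inj {r θ r' θ' : ℝ} (hθ : D.θ₀ ≤ θ) (h1 : D.r₁ θ ≤ r) (h2 : r ≤ D.r₂ θ)
    (hθ' : D.θ₀ ≤ θ') (h1' : D.r₁ θ' ≤ r') (h2' : r' ≤ D.r₂ θ')
    (h : polarX r θ = polarX r' θ') : r = r' ∧ θ = θ' := by
  have hr : 0 < r := (D.r₁_pos θ hθ).trans_le h1
  have hr' : 0 < r' := (D.r₁_pos θ' hθ').trans_le h1'
  have hc : r * Real.cos θ = r' * Real.cos θ' := by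
    simpa [polarX] using congrArg (fun x : Plane => x 0) h
  have hs : r * Real.sin θ = r' * Real.sin θ' := by
    simpa [polarX] using congrArg (fun x : Plane => x 1) h
  have hrr : r = r' := by
    have e : r ^ 2 = r' ^ 2 := by
      have a := Real.sin_sq_add_cos_sq θ
      have b := Real.sin_sq_add_cos_sq θ'
      calc r ^ 2 = (r * Real.cos θ) ^ 2 + (r * Real.sin θ) ^ 2 := by linear_combination (-r ^ 2) * a
        _ = (r' * Real.cos θ') ^ 2 + (r' * Real.sin θ') ^ 2 := by rw [hc, hs]
        _ = r' ^ 2 := by linear_combination (r' ^ 2) * b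
    exact (pow_left_inj₀ hr.le hr'.le two_ne_zero).1 e
  subst hrr
  refine ⟨rfl, ?_⟩
  have hc' := mul_left_cancel₀ hr.ne' hc
  have hs' := mul_left_cancel₀ hr.ne' hs
  have hang : (θ : Real.Angle) = θ' := Real.Angle.cos_sin_inj hc' hs'
  obtain ⟨k, hk⟩ := Real.Angle.angle_eq_iff_two_pi_dvd_sub.1 hang
  rcases lt_trichotomy k 0 with hk0 | hk0 | hk0
  · obtain ⟨n, hn⟩ : ∃ n : ℕ, k = -((n : ℤ) + 1) := ⟨(-k - 1).toNat, by omega⟩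
    have hkr : (k : ℝ) = -((n : ℝ) + 1) := by rw [hn]; push_cast; ring
    have := D.r₂_lt_r₁_of_pos hθ n
    have e : θ + ((n : ℝ) + 1) * (2 * Real.pi) = θ' := by rw [hkr] at hk; linarith
    rw [e] at this
    linarith
  · subst hk0
    simp at hk
    linarith
  · obtain ⟨n, hn⟩ : ∃ n : ℕ, k = (n : ℤ) + 1 := ⟨(k - 1).toNat, by omega⟩
    have hkr : (k : ℝ) = (n : ℝ) + 1 := by rw [hn]; push_cast; ring
    have := D.r₂_lt_r₁_of_pos hθ' n
    have e : θ' + ((n : ℝ) + 1) * (2 * Real.pi) = θ := by rw [hkr] at hk; linarith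
    rw [e] at this
    linarith

/-- The arc-distance is well defined. -/
theorem arcDist_midCurve {l θ : ℝ} (hl : l ∈ Icc (0 : ℝ) 1) (hθ : D.θ₀ ≤ θ) :
    D.arcDist (D.midCurve l θ) = D.arcLength l θ := by
  have h : ∃ p : ℝ × ℝ, p.1 ∈ Icc (0 : ℝ) 1 ∧ D.θ₀ ≤ p.2 ∧
      D.midCurve l θ = D.midCurve p.1 p.2 := ⟨(l, θ), hl, hθ, rfl⟩
  unfold arcDist
  rw [dif_pos h]
  obtain ⟨hl', hθ', he⟩ := h.choose_spec
  have hb : ∀ {m η : ℝ}, m ∈ Icc (0 : ℝ) 1 → D.θ₀ ≤ η →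
      D.r₁ η ≤ (1 - m) * D.r₁ η + m * D.r₂ η ∧ (1 - m) * D.r₁ η + m * D.r₂ η ≤ D.r₂ η := by
    intro m η hm hη
    have := D.r₁_lt_r₂ η hη
    constructor <;> nlinarith [hm.1, hm.2]
  obtain ⟨e1, e2⟩ := D.polarX_inj hθ (hb hl hθ).1 (hb hl hθ).2 hθ' (hb hl' hθ').1 (hb hl' hθ').2 he
  rw [← e2] at e1 ⊢
  have hlt := D.r₁_lt_r₂ θ hθ
  have : l = h.choose.1 := by
    have hm : (l - h.choose.1) * (D.r₂ θ - D.r₁ θ) = 0 := by linear_combination e1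
    rcases mul_eq_zero.1 hm with h0 | h0 <;> linarith
  rw [← this]

end WindingDomain

/-- The partial derivative `∂u/∂xᵢ`. -/
def partialD (i : Fin 2) (u : Plane → ℝ) (x : Plane) : ℝ :=
  fderiv ℝ u x (EuclideanSpace.single i 1)

/-- The operator `Lu = - ∑ aᵢⱼ ∂²u/∂xᵢ∂xⱼ + b · ∇u`. -/
def ellipticOp (A : Plane → Matrix (Fin 2) (Fin 2) ℝ) (b : Plane → Plane) (u : Plane → ℝ)
    (x : Plane) : ℝ :=
  -(∑ i, ∑ j, A x i j * partialD i (partialD j u) x) + ∑ i, b x i * partialD i u x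

/-- The matrices `A(x)`, `x ∈ Ω`, are symmetric and uniformly elliptic with bounded traces. -/
def UniformlyElliptic (Ω : Set Plane) (A : Plane → Matrix (Fin 2) (Fin 2) ℝ) : Prop :=
  (∀ x ∈ Ω, (A x).IsSymm) ∧
  (∃ c₀ : ℝ, 0 < c₀ ∧ ∀ x ∈ Ω, ∀ ξ : Plane, c₀ * ‖ξ‖ ^ 2 ≤ ∑ i, ∑ j, ξ i * A x i j * ξ j) ∧
  ∃ M₁ : ℝ, 0 < M₁ ∧ ∀ x ∈ Ω, (A x).trace ≤ M₁

/-- The drift `b` is bounded on `Ω`. -/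
def BoundedDrift (Ω : Set Plane) (b : Plane → Plane) : Prop :=
  ∃ M₂ : ℝ, 0 ≤ M₂ ∧ ∀ x ∈ Ω, ‖b x‖ ≤ M₂

end

noncomputable section

/-! ### The operator on `C²` functions -/

/-! The proof is a Phragmén–Lindelöf comparison with the barriers `e^{sθ}(K - e^{a x₀})`, where `x₀`
is the first coordinate. For `s = 0`, applying `L` gives `a e^{a x₀}(a a₀₀ - b₀)`, which is bounded
below by a positive constant once `a` is large relative to the drift. The channel is bounded and
stays away from the origin, so the first and second derivatives of `θ` are bounded and `s ≠ 0` costs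
only `O(s)`. Hence there is one `ν > 0` for which both `s = -ν` and `s = ν` give strict
supersolutions (`exists_strict_barrier`).

A subsolution `u` is compared with `W = m + κ·(barrier with -ν) + δ·(barrier with ν)`. The growing
term dominates `u` far along the channel, because `u` is below exponential growth. A positive
maximum of `u - W` would therefore be interior, where `L(u - W) ≥ 0` contradicts `Lu ≤ 0 < LW`
(`le_add_growing_barrier`). Letting `δ → 0` leaves `m` plus the decaying barrier: `κ = 0` gives the
maximum principle, and constant part `0` gives decay at rate `ν` (`exists_decay`).

Since `θ` is multivalued in the plane, maximization takes place in the coordinates `(r, θ)`, and a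
local branch of the angle is used only to differentiate. For the second part, arc-length along the
channel grows at most linearly in `θ`, uniformly in `λ` (`exists_arcLength_le`), so decay in `θ`
becomes decay in `ℒ`. -/

theorem partialD_differentiableAt {u : Plane → ℝ} {x : Plane} (hu : ContDiffAt ℝ 2 u x)
    (i : Fin 2) : DifferentiableAt ℝ (partialD i u) x := by
  have h : ContDiffAt ℝ 1 (fderiv ℝ u) x := hu.fderiv_right (by norm_num)
  exact (h.differentiableAt (by norm_num)).clm_apply (differentiableAt_const _)

theorem ContDiffAt.eventually_differentiableAt_two {u : Plane → ℝ} {x : Plane}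
    (hu : ContDiffAt ℝ 2 u x) : ∀ᶠ y in 𝓝 x, DifferentiableAt ℝ u y :=
  (hu.eventually (by simp)).mono fun _ hy => hy.differentiableAt (by norm_num)

theorem partialD_add {u v : Plane → ℝ} {x : Plane} (hu : DifferentiableAt ℝ u x)
    (hv : DifferentiableAt ℝ v x) (i : Fin 2) :
    partialD i (u + v) x = partialD i u x + partialD i v x := by
  simp [partialD, fderiv_add hu hv]

theorem partialD_const_smul (c : ℝ) (u : Plane → ℝ) (x : Plane) (i : Fin 2) :
    partialD i (c • u) x = c * partialD i u x := by
  simp [partialD, fderiv_const_smul_field]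

theorem partialD_congr {u v : Plane → ℝ} {x : Plane} (h : u =ᶠ[𝓝 x] v) (i : Fin 2) :
    partialD i u x = partialD i v x := by
  simp only [partialD, h.fderiv_eq]

theorem ellipticOp_add {A : Plane → Matrix (Fin 2) (Fin 2) ℝ} {b : Plane → Plane}
    {u v : Plane → ℝ} {x : Plane} (hu : ContDiffAt ℝ 2 u x) (hv : ContDiffAt ℝ 2 v x) :
    ellipticOp A b (u + v) x = ellipticOp A b u x + ellipticOp A b v x := by
  have h1 := partialD_add (hu.differentiableAt (by norm_num)) (hv.differentiableAt (by norm_num))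
  have h2 : ∀ i j, partialD i (partialD j (u + v)) x =
      partialD i (partialD j u) x + partialD i (partialD j v) x := by
    intro i j
    rw [← partialD_add (partialD_differentiableAt hu j) (partialD_differentiableAt hv j)]
    apply partialD_congr
    filter_upwards [hu.eventually_differentiableAt_two, hv.eventually_differentiableAt_two]
      with y hy hy'
    exact partialD_add hy hy' j
  simp only [ellipticOp, h1, h2, Fin.sum_univ_two]
  ring

theorem ellipticOp_const_smul (A : Plane → Matrix (Fin 2) (Fin 2) ℝ) (b : Plane → Plane)
    (c : ℝ) (u : Plane → ℝ) (x : Plane) :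
    ellipticOp A b (c • u) x = c * ellipticOp A b u x := by
  have h2 : ∀ j, partialD j (c • u) = c • partialD j u := by
    intro j
    ext y
    simpa using partialD_const_smul c u y j
  simp only [ellipticOp, h2, partialD_const_smul, Fin.sum_univ_two]
  ring

theorem ellipticOp_const (A : Plane → Matrix (Fin 2) (Fin 2) ℝ) (b : Plane → Plane)
    (c : ℝ) (x : Plane) : ellipticOp A b (fun _ => c) x = 0 := by
  have h : ∀ c : ℝ, ∀ j, partialD j (fun _ : Plane => c) = fun _ => 0 := by
    intro c j
    ext y
    simp [partialD]
  simp [ellipticOp, h]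

/-! ### The second derivative test -/

/-- A positive second derivative at a critical point would make `t` a local minimum too. Then `g`
would be locally constant and its second derivative zero. -/
theorem deriv_deriv_nonpos_of_isLocalMax {g : ℝ → ℝ} {t : ℝ} (h : IsLocalMax g t)
    (hc : ContinuousAt g t) : deriv (deriv g) t ≤ 0 := by
  by_contra! hpos
  have hmin : IsLocalMin g t := isLocalMin_of_deriv_deriv_pos hpos h.deriv_eq_zero hc
  have hconst : g =ᶠ[𝓝 t] fun _ => g t := by
    filter_upwards [h, hmin] with s h1 h2 using le_antisymm h1 h2
  rw [hconst.deriv.deriv_eq] at hpos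
  simp at hpos

theorem fderiv_eq_partialD (u : Plane → ℝ) (x ξ : Plane) :
    fderiv ℝ u x ξ = ξ 0 * partialD 0 u x + ξ 1 * partialD 1 u x := by
  have : ξ = ξ 0 • EuclideanSpace.single 0 (1 : ℝ) + ξ 1 • EuclideanSpace.single 1 (1 : ℝ) := by
    ext i
    fin_cases i <;> simp
  conv_lhs => rw [this]
  simp [partialD]

/-- This is the one-variable test along the line through `x` in direction `(p, q)`. Keeping the two
mixed derivatives separate avoids any appeal to their symmetry. -/
theorem hessian_nonpos_of_isLocalMax {v : Plane → ℝ} {x : Plane} (hv : ContDiffAt ℝ 2 v x)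
    (h : IsLocalMax v x) (p q : ℝ) :
    p * p * partialD 0 (partialD 0 v) x + p * q * partialD 0 (partialD 1 v) x
      + p * q * partialD 1 (partialD 0 v) x + q * q * partialD 1 (partialD 1 v) x ≤ 0 := by
  set ξ : Plane := !₂[p, q]
  have hline : ∀ t : ℝ, HasDerivAt (fun s : ℝ => x + s • ξ) ξ t := by
    intro t
    simpa using ((hasDerivAt_id t).smul_const ξ).const_add x
  have hcont : Continuous fun s : ℝ => x + s • ξ := by fun_prop
  have hto : Tendsto (fun s : ℝ => x + s • ξ) (𝓝 0) (𝓝 x) := by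
    simpa using hcont.tendsto 0
  have hmax : IsLocalMax (fun s : ℝ => v (x + s • ξ)) 0 := by
    have := hto.eventually h
    simpa [IsLocalMax, IsMaxFilter] using this
  have hd : deriv (fun s : ℝ => v (x + s • ξ)) =ᶠ[𝓝 0]
      fun s => p * partialD 0 v (x + s • ξ) + q * partialD 1 v (x + s • ξ) := by
    filter_upwards [hto.eventually hv.eventually_differentiableAt_two] with s hs
    have := (hs.hasFDerivAt.comp_hasDerivAt s (hline s)).deriv
    simpa [Function.comp_def, fderiv_eq_partialD, ξ] using this
  have hc : ContinuousAt (fun s : ℝ => v (x + s • ξ)) 0 := by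
    apply ContinuousAt.comp (g := v)
    · simpa using hv.continuousAt
    · exact hcont.continuousAt
  have h2 := deriv_deriv_nonpos_of_isLocalMax hmax hc
  rw [hd.deriv_eq] at h2
  have e : ∀ j, HasDerivAt (fun s : ℝ => partialD j v (x + s • ξ))
      (p * partialD 0 (partialD j v) x + q * partialD 1 (partialD j v) x) 0 := by
    intro j
    have h0 : HasFDerivAt (partialD j v) (fderiv ℝ (partialD j v) x) (x + (0 : ℝ) • ξ) := by
      simpa using (partialD_differentiableAt hv j).hasFDerivAt
    have := h0.comp_hasDerivAt 0 (hline 0)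
    simpa [Function.comp_def, fderiv_eq_partialD, ξ] using this
  rw [(((e 0).const_mul p).fun_add ((e 1).const_mul q)).deriv] at h2
  linarith

/-- At an interior maximum, `Lv ≥ 0`. -/
theorem ellipticOp_nonneg_of_isLocalMax {A : Plane → Matrix (Fin 2) (Fin 2) ℝ}
    {b : Plane → Plane} {v : Plane → ℝ} {x : Plane} (hv : ContDiffAt ℝ 2 v x)
    (h : IsLocalMax v x) (hsymm : A x 1 0 = A x 0 1) (h00 : 0 < A x 0 0)
    (hdet : 0 ≤ A x 0 0 * A x 1 1 - A x 0 1 ^ 2) : 0 ≤ ellipticOp A b v x := by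
  have hgrad : ∀ i, partialD i v x = 0 := fun i => by simp [partialD, h.fderiv_eq_zero]
  -- Completing the square replaces diagonalization: with `H` the Hessian, `a₀₀ tr(AH)` equals `H`
  -- evaluated on `(a₀₀, a₀₁)` plus `det A` times `H` evaluated on `(0, 1)`.
  have h1 := hessian_nonpos_of_isLocalMax hv h (A x 0 0) (A x 0 1)
  have h2 := mul_nonpos_of_nonneg_of_nonpos hdet (hessian_nonpos_of_isLocalMax hv h 0 1)
  simp only [ellipticOp, hgrad, Fin.sum_univ_two, hsymm]
  have h3 : A x 0 0 * (A x 0 0 * partialD 0 (partialD 0 v) x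
      + A x 0 1 * partialD 0 (partialD 1 v) x + (A x 0 1 * partialD 1 (partialD 0 v) x
      + A x 1 1 * partialD 1 (partialD 1 v) x)) ≤ 0 := by linarith
  have h4 := nonpos_of_mul_nonpos_right h3 h00
  linarith

/-! ### The local angle -/

/-- The branch of the polar angle with values in `(t - π / 2, t + π / 2)`. -/
def angleNear (t : ℝ) (x : Plane) : ℝ :=
  t + Real.arctan ((-Real.sin t * x 0 + Real.cos t * x 1) / (Real.cos t * x 0 + Real.sin t * x 1))

/-- The half-plane on which `angleNear t` is smooth. -/
def angleHalfPlane (t : ℝ) : Set Plane := {x | 0 < Real.cos t * x 0 + Real.sin t * x 1}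

theorem isOpen_angleHalfPlane (t : ℝ) : IsOpen (angleHalfPlane t) :=
  isOpen_lt continuous_const (by fun_prop)

theorem polarX_mem_angleHalfPlane {r : ℝ} (hr : 0 < r) (t : ℝ) :
    polarX r t ∈ angleHalfPlane t := by
  have := Real.sin_sq_add_cos_sq t
  have e : Real.cos t * (r * Real.cos t) + Real.sin t * (r * Real.sin t) = r := by
    linear_combination r * this
  simpa [angleHalfPlane, polarX, e] using hr

theorem angleNear_polarX (r t : ℝ) : angleNear t (polarX r t) = t := by
  have : -(Real.sin t * (r * Real.cos t)) + Real.cos t * (r * Real.sin t) = 0 := by ring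
  simp [angleNear, polarX, this]

theorem norm_polarX {r : ℝ} (hr : 0 ≤ r) (t : ℝ) : ‖polarX r t‖ = r := by
  rw [EuclideanSpace.norm_eq, Real.sqrt_eq_iff_mul_self_eq (by positivity) hr]
  simp only [polarX, Fin.sum_univ_two, Real.norm_eq_abs, sq_abs]
  have := Real.sin_sq_add_cos_sq t
  simp
  linear_combination r ^ 2 * this

/-- Here `d` and `n` are the coordinates of `x` in the frame rotated by `t`. Since `d > 0`, the
angle of `x` from the first rotated axis is `arctan (n / d)`. -/
theorem polarX_norm_angleNear {t : ℝ} {x : Plane} (hx : x ∈ angleHalfPlane t) :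
    polarX ‖x‖ (angleNear t x) = x := by
  set d := Real.cos t * x 0 + Real.sin t * x 1 with hd
  set n := -Real.sin t * x 0 + Real.cos t * x 1 with hn
  have hd0 : 0 < d := hx
  have hcs := Real.sin_sq_add_cos_sq t
  have hnd : x 0 ^ 2 + x 1 ^ 2 = d ^ 2 + n ^ 2 := by
    rw [hd, hn]
    linear_combination (-(x 0) ^ 2 - (x 1) ^ 2) * hcs
  have hnorm : ‖x‖ = √(d ^ 2 + n ^ 2) := by
    rw [EuclideanSpace.norm_eq, ← hnd]
    simp [Fin.sum_univ_two]
  have hs : √(1 + (n / d) ^ 2) = ‖x‖ / d := by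
    rw [hnorm, show 1 + (n / d) ^ 2 = (d ^ 2 + n ^ 2) / d ^ 2 by field_simp,
      Real.sqrt_div (by positivity), Real.sqrt_sq hd0.le]
  have hpos : 0 < ‖x‖ := by rw [hnorm]; positivity
  have hc : ‖x‖ * Real.cos (Real.arctan (n / d)) = d := by
    rw [Real.cos_arctan, hs]; field_simp
  have hsn : ‖x‖ * Real.sin (Real.arctan (n / d)) = n := by
    rw [Real.sin_arctan, hs]; field_simp
  have e : angleNear t x = t + Real.arctan (n / d) := rfl
  ext i
  fin_cases i
  · simp only [polarX, e, Real.cos_add]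
    simp
    linear_combination Real.cos t * hc - Real.sin t * hsn + Real.cos t * hd - Real.sin t * hn
      + x 0 * hcs
  · simp only [polarX, e, Real.sin_add]
    simp
    linear_combination Real.sin t * hc + Real.cos t * hsn + Real.sin t * hd + Real.cos t * hn
      + x 1 * hcs

theorem contDiffAt_angleNear {t : ℝ} {x : Plane} (hx : x ∈ angleHalfPlane t) :
    ContDiffAt ℝ 2 (angleNear t) x := by
  have hx' : Real.cos t * x 0 + Real.sin t * x 1 ≠ 0 := ne_of_gt hx
  unfold angleNear
  exact contDiffAt_const.add (Real.contDiff_arctan.contDiffAt.comp x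
    (ContDiffAt.div (by fun_prop) (by fun_prop) hx'))

/-! ### Differentials recorded by their two coefficients -/

/-- The covector `p dx₀ + q dx₁`. -/
def covec (p q : ℝ) : Plane →L[ℝ] ℝ :=
  p • EuclideanSpace.proj (0 : Fin 2) + q • EuclideanSpace.proj (1 : Fin 2)

theorem covec_apply (p q : ℝ) (ξ : Plane) : covec p q ξ = p * ξ 0 + q * ξ 1 := by
  simp [covec]

theorem hasFDerivAt_coord_zero (x : Plane) :
    HasFDerivAt (fun y : Plane => y 0) (covec 1 0) x := by
  simpa [covec] using (EuclideanSpace.proj (𝕜 := ℝ) (0 : Fin 2) : Plane →L[ℝ] ℝ).hasFDerivAt (x := x)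

theorem hasFDerivAt_coord_one (x : Plane) :
    HasFDerivAt (fun y : Plane => y 1) (covec 0 1) x := by
  simpa [covec] using (EuclideanSpace.proj (𝕜 := ℝ) (1 : Fin 2) : Plane →L[ℝ] ℝ).hasFDerivAt (x := x)

theorem partialD_zero_of_hasFDerivAt {f : Plane → ℝ} {p q : ℝ} {x : Plane}
    (h : HasFDerivAt f (covec p q) x) : partialD 0 f x = p := by
  simp [partialD, h.fderiv, covec_apply]

theorem partialD_one_of_hasFDerivAt {f : Plane → ℝ} {p q : ℝ} {x : Plane}
    (h : HasFDerivAt f (covec p q) x) : partialD 1 f x = q := by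
  simp [partialD, h.fderiv, covec_apply]

theorem normSq_pos_of_mem_angleHalfPlane {t : ℝ} {x : Plane} (hx : x ∈ angleHalfPlane t) :
    0 < x 0 ^ 2 + x 1 ^ 2 := by
  by_contra! h
  have h0 : x 0 = 0 := by nlinarith [sq_nonneg (x 0), sq_nonneg (x 1)]
  have h1 : x 1 = 0 := by nlinarith [sq_nonneg (x 0), sq_nonneg (x 1)]
  simp [angleHalfPlane, h0, h1] at hx

theorem HasFDerivAt.covec_mul {f g : Plane → ℝ} {p q p' q' : ℝ} {x : Plane}
    (hf : HasFDerivAt f (covec p q) x) (hg : HasFDerivAt g (covec p' q') x) :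
    HasFDerivAt (fun y => f y * g y) (covec (p * g x + f x * p') (q * g x + f x * q')) x := by
  refine (hf.fun_mul hg).congr_fderiv ?_
  ext ξ
  simp [covec_apply]
  ring

theorem HasFDerivAt.covec_add {f g : Plane → ℝ} {p q p' q' : ℝ} {x : Plane}
    (hf : HasFDerivAt f (covec p q) x) (hg : HasFDerivAt g (covec p' q') x) :
    HasFDerivAt (fun y => f y + g y) (covec (p + p') (q + q')) x := by
  refine (hf.fun_add hg).congr_fderiv ?_
  ext ξ
  simp [covec_apply]
  ring

theorem HasDerivAt.comp_covec {φ : ℝ → ℝ} {f : Plane → ℝ} {c p q : ℝ} {x : Plane}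
    (hφ : HasDerivAt φ c (f x)) (hf : HasFDerivAt f (covec p q) x) :
    HasFDerivAt (fun y => φ (f y)) (covec (c * p) (c * q)) x := by
  refine (hφ.comp_hasFDerivAt x hf).congr_fderiv ?_
  ext ξ
  simp [covec_apply]
  ring

theorem hasFDerivAt_covec_const (c : ℝ) (x : Plane) :
    HasFDerivAt (fun _ : Plane => c) (covec 0 0) x := by
  simpa [covec] using hasFDerivAt_const c x

theorem HasFDerivAt.covec_div {f g : Plane → ℝ} {p q p' q' : ℝ} {x : Plane}
    (hf : HasFDerivAt f (covec p q) x) (hg : HasFDerivAt g (covec p' q') x) (h0 : g x ≠ 0) :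
    HasFDerivAt (fun y => f y / g y) (covec ((p * g x - f x * p') / g x ^ 2)
      ((q * g x - f x * q') / g x ^ 2)) x := by
  have := hf.covec_mul ((hasDerivAt_inv h0).comp_covec hg)
  simp only [div_eq_mul_inv]
  convert this using 2 <;> field_simp <;> ring

theorem HasFDerivAt.covec_congr {f : Plane → ℝ} {p q p' q' : ℝ} {x : Plane}
    (hf : HasFDerivAt f (covec p q) x) (hp : p = p') (hq : q = q') :
    HasFDerivAt f (covec p' q') x := by
  subst hp hq; exact hf

/-- The differential `(-x₁ dx₀ + x₀ dx₁)/|x|²` does not depend on `t`: branches of the angle differ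
by constants. All later estimates are therefore independent of the branch. -/
theorem hasFDerivAt_angleNear {t : ℝ} {x : Plane} (hx : x ∈ angleHalfPlane t) :
    HasFDerivAt (angleNear t)
      (covec (-x 1 / (x 0 ^ 2 + x 1 ^ 2)) (x 0 / (x 0 ^ 2 + x 1 ^ 2))) x := by
  have hx' : 0 < Real.cos t * x 0 + Real.sin t * x 1 := hx
  have hN := normSq_pos_of_mem_angleHalfPlane hx
  have hcs := Real.sin_sq_add_cos_sq t
  have h0 := hasFDerivAt_coord_zero x
  have h1 := hasFDerivAt_coord_one x
  have c := fun c => hasFDerivAt_covec_const c x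
  have hn := ((c (-Real.sin t)).covec_mul h0).covec_add ((c (Real.cos t)).covec_mul h1)
  have hd := ((c (Real.cos t)).covec_mul h0).covec_add ((c (Real.sin t)).covec_mul h1)
  have := (c t).covec_add ((Real.hasDerivAt_arctan _).comp_covec (hn.covec_div hd hx'.ne'))
  have hnd : x 0 ^ 2 + x 1 ^ 2 = (Real.cos t * x 0 + Real.sin t * x 1) ^ 2
      + (-Real.sin t * x 0 + Real.cos t * x 1) ^ 2 := by
    linear_combination (-(x 0) ^ 2 - (x 1) ^ 2) * hcs
  have key : ∀ d n m : ℝ, 0 < d →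
      0 + 1 / (1 + (n / d) ^ 2) * (m / d ^ 2) = m / (d ^ 2 + n ^ 2) := by
    intro d n m hd
    have : 0 < d ^ 2 + n ^ 2 := by positivity
    field_simp
    ring
  refine this.covec_congr ?_ ?_
  · rw [key _ _ _ hx', hnd]
    congr 1
    linear_combination (-x 1) * hcs
  · rw [key _ _ _ hx', hnd]
    congr 1
    linear_combination (x 0) * hcs

/-! ### The barrier -/

/-- The barrier `e^{s θ} (K - e^{a x₀})`, with the branch `angleNear t` of the angle `θ`. -/
def barrier (a K s t : ℝ) (x : Plane) : ℝ :=
  Real.exp (s * angleNear t x) * (K - Real.exp (a * x 0))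

theorem contDiffAt_barrier (a K s : ℝ) {t : ℝ} {x : Plane} (hx : x ∈ angleHalfPlane t) :
    ContDiffAt ℝ 2 (barrier a K s t) x := by
  have := contDiffAt_angleNear hx
  unfold barrier
  exact (contDiffAt_const.mul this).exp.mul (by fun_prop)

theorem hasFDerivAt_expAngle (s : ℝ) {t : ℝ} {x : Plane} (hx : x ∈ angleHalfPlane t) :
    HasFDerivAt (fun y => Real.exp (s * angleNear t y))
      (covec (Real.exp (s * angleNear t x) * (s * (-x 1 / (x 0 ^ 2 + x 1 ^ 2))))
        (Real.exp (s * angleNear t x) * (s * (x 0 / (x 0 ^ 2 + x 1 ^ 2))))) x :=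
  ((Real.hasDerivAt_exp _).comp_covec
    ((hasFDerivAt_covec_const s x).covec_mul (hasFDerivAt_angleNear hx))).covec_congr
      (by ring) (by ring)

theorem hasFDerivAt_expCoord (a : ℝ) (x : Plane) :
    HasFDerivAt (fun y : Plane => Real.exp (a * y 0)) (covec (a * Real.exp (a * x 0)) 0) x :=
  ((Real.hasDerivAt_exp _).comp_covec
    ((hasFDerivAt_covec_const a x).covec_mul (hasFDerivAt_coord_zero x))).covec_congr
      (by ring) (by ring)

theorem hasFDerivAt_normSq (x : Plane) :
    HasFDerivAt (fun y : Plane => y 0 ^ 2 + y 1 ^ 2) (covec (2 * x 0) (2 * x 1)) x := by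
  have h0 := hasFDerivAt_coord_zero x
  have h1 := hasFDerivAt_coord_one x
  simp only [pow_two]
  exact ((h0.covec_mul h0).covec_add (h1.covec_mul h1)).covec_congr (by ring) (by ring)

theorem hasFDerivAt_angle_zero {x : Plane} (hN : 0 < x 0 ^ 2 + x 1 ^ 2) :
    HasFDerivAt (fun y : Plane => -y 1 / (y 0 ^ 2 + y 1 ^ 2))
      (covec (2 * x 0 * x 1 / (x 0 ^ 2 + x 1 ^ 2) ^ 2)
        ((x 1 ^ 2 - x 0 ^ 2) / (x 0 ^ 2 + x 1 ^ 2) ^ 2)) x := by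
  have h := ((hasFDerivAt_covec_const (-1) x).covec_mul (hasFDerivAt_coord_one x)).covec_div
    (hasFDerivAt_normSq x) hN.ne'
  simp only [neg_one_mul] at h
  refine h.covec_congr ?_ ?_ <;> congr 1 <;> ring

theorem hasFDerivAt_angle_one {x : Plane} (hN : 0 < x 0 ^ 2 + x 1 ^ 2) :
    HasFDerivAt (fun y : Plane => y 0 / (y 0 ^ 2 + y 1 ^ 2))
      (covec ((x 1 ^ 2 - x 0 ^ 2) / (x 0 ^ 2 + x 1 ^ 2) ^ 2)
        (-(2 * x 0 * x 1 / (x 0 ^ 2 + x 1 ^ 2) ^ 2))) x := by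
  have h := (hasFDerivAt_coord_zero x).covec_div (hasFDerivAt_normSq x) hN.ne'
  refine h.covec_congr ?_ ?_
  · congr 1; ring
  · rw [← neg_div]; congr 1; ring

theorem hasFDerivAt_barrier (a K s : ℝ) {t : ℝ} {x : Plane} (hx : x ∈ angleHalfPlane t) :
    HasFDerivAt (barrier a K s t)
      (covec (Real.exp (s * angleNear t x) * (s * (-x 1 / (x 0 ^ 2 + x 1 ^ 2))
          * (K - Real.exp (a * x 0)) + -a * Real.exp (a * x 0)))
        (Real.exp (s * angleNear t x) * (s * (x 0 / (x 0 ^ 2 + x 1 ^ 2))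
          * (K - Real.exp (a * x 0))))) x := by
  have h := (hasFDerivAt_expAngle s hx).covec_mul ((hasFDerivAt_covec_const K x).covec_add
    ((hasFDerivAt_covec_const (-1) x).covec_mul (hasFDerivAt_expCoord a x)))
  simp only [neg_one_mul, ← sub_eq_add_neg] at h
  exact h.covec_congr (by ring) (by ring)

theorem hasFDerivAt_const_sub_expCoord (a K : ℝ) (x : Plane) :
    HasFDerivAt (fun y : Plane => K - Real.exp (a * y 0)) (covec (-a * Real.exp (a * x 0)) 0) x := by
  have h := (hasFDerivAt_covec_const K x).covec_add
    ((hasFDerivAt_covec_const (-1) x).covec_mul (hasFDerivAt_expCoord a x))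
  simp only [neg_one_mul, ← sub_eq_add_neg] at h
  exact h.covec_congr (by ring) (by ring)

/-- The terms are grouped so that the part surviving at `s = 0` stands apart and everything else
carries a factor `s`. In the notation, `(p, q)` is the gradient of the angle and `h, k, -h` are its
second derivatives `θ₀₀, θ₀₁, θ₁₁`; its Laplacian vanishes. -/
theorem ellipticOp_barrier {A : Plane → Matrix (Fin 2) (Fin 2) ℝ} {b : Plane → Plane}
    (a K s : ℝ) {t : ℝ} {x : Plane} (hx : x ∈ angleHalfPlane t) (hsymm : A x 1 0 = A x 0 1)
    {E G p q h k : ℝ} (hE : E = Real.exp (a * x 0)) (hG : G = K - E)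
    (hp : p = -x 1 / (x 0 ^ 2 + x 1 ^ 2)) (hq : q = x 0 / (x 0 ^ 2 + x 1 ^ 2))
    (hh : h = 2 * x 0 * x 1 / (x 0 ^ 2 + x 1 ^ 2) ^ 2)
    (hk : k = (x 1 ^ 2 - x 0 ^ 2) / (x 0 ^ 2 + x 1 ^ 2) ^ 2) :
    ellipticOp A b (barrier a K s t) x = Real.exp (s * angleNear t x) *
      (a * E * (a * A x 0 0 - b x 0) - s * (A x 0 0 * (s * p ^ 2 * G - 2 * a * p * E + h * G)
        + 2 * A x 0 1 * (s * p * q * G + k * G - a * q * E) + A x 1 1 * (s * q ^ 2 * G - h * G)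
        - b x 0 * p * G - b x 1 * q * G)) := by
  have hN := normSq_pos_of_mem_angleHalfPlane hx
  have hD := hasFDerivAt_barrier a K s hx
  have hev : ∀ᶠ y in 𝓝 x, y ∈ angleHalfPlane t := (isOpen_angleHalfPlane t).mem_nhds hx
  have h0 : partialD 0 (barrier a K s t) =ᶠ[𝓝 x] fun y => Real.exp (s * angleNear t y) *
      (s * (-y 1 / (y 0 ^ 2 + y 1 ^ 2)) * (K - Real.exp (a * y 0)) + -a * Real.exp (a * y 0)) :=
    hev.mono fun y hy => partialD_zero_of_hasFDerivAt (hasFDerivAt_barrier a K s hy)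
  have h1 : partialD 1 (barrier a K s t) =ᶠ[𝓝 x] fun y => Real.exp (s * angleNear t y) *
      (s * (y 0 / (y 0 ^ 2 + y 1 ^ 2)) * (K - Real.exp (a * y 0))) :=
    hev.mono fun y hy => partialD_one_of_hasFDerivAt (hasFDerivAt_barrier a K s hy)
  have c := fun c => hasFDerivAt_covec_const c x
  have g0 := (hasFDerivAt_expAngle s hx).covec_mul
    ((((c s).covec_mul (hasFDerivAt_angle_zero hN)).covec_mul
      (hasFDerivAt_const_sub_expCoord a K x)).covec_add ((c (-a)).covec_mul
        (hasFDerivAt_expCoord a x)))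
  have g1 := (hasFDerivAt_expAngle s hx).covec_mul
    (((c s).covec_mul (hasFDerivAt_angle_one hN)).covec_mul
      (hasFDerivAt_const_sub_expCoord a K x))
  simp only [ellipticOp, Fin.sum_univ_two, hsymm, partialD_congr h0, partialD_congr h1,
    partialD_zero_of_hasFDerivAt hD, partialD_one_of_hasFDerivAt hD,
    partialD_zero_of_hasFDerivAt g0, partialD_one_of_hasFDerivAt g0,
    partialD_zero_of_hasFDerivAt g1, partialD_one_of_hasFDerivAt g1]
  rw [← hE, ← hG, ← hp, ← hq, ← hh, ← hk]
  ring

end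

noncomputable section

/-! ### Bounds for the barrier -/

theorem abs_mul_le_mul {x y X Y : ℝ} (hx : |x| ≤ X) (hy : |y| ≤ Y) : |x * y| ≤ X * Y := by
  rw [abs_mul]
  exact mul_le_mul hx hy (abs_nonneg _) ((abs_nonneg _).trans hx)

/-- This bounds the cofactor of `s` in `ellipticOp_barrier` uniformly for `|s| ≤ 1`. The three
coefficients 4 arise by summing over the matrix entries, with the off-diagonal one counted twice. -/
theorem abs_barrier_remainder_le {a₀ a₁ a₂ b₀ b₁ s p q h k E G a M N B F : ℝ}
    (h0 : |a₀| ≤ M) (h1 : |a₁| ≤ M) (h2 : |a₂| ≤ M) (hb0 : |b₀| ≤ N) (hb1 : |b₁| ≤ N)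
    (hs : |s| ≤ 1) (hp : |p| ≤ B) (hq : |q| ≤ B) (hh : |h| ≤ B) (hk : |k| ≤ B)
    (hE : |E| ≤ F) (hG : |G| ≤ F) (ha : 0 ≤ a) :
    |a₀ * (s * p ^ 2 * G - 2 * a * p * E + h * G)
        + 2 * a₁ * (s * p * q * G + k * G - a * q * E) + a₂ * (s * q ^ 2 * G - h * G)
        - b₀ * p * G - b₁ * q * G| ≤
      M * (4 * B ^ 2 * F + 4 * a * B * F + 4 * B * F) + 2 * N * B * F := by
  have hB : 0 ≤ B := (abs_nonneg _).trans hp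
  have hpp : ∀ {y z}, |y| ≤ B → |z| ≤ B → |s * (y * z) * G| ≤ 1 * (B * B) * F := fun hy hz =>
    abs_mul_le_mul (abs_mul_le_mul hs (abs_mul_le_mul hy hz)) hG
  have haE : ∀ {y}, |y| ≤ B → |a * y * E| ≤ a * B * F := fun hy =>
    abs_mul_le_mul (abs_mul_le_mul (abs_of_nonneg ha).le hy) hE
  have hyG : ∀ {y}, |y| ≤ B → |y * G| ≤ B * F := fun hy => abs_mul_le_mul hy hG
  have e1 : |s * (p * p) * G - 2 * (a * p * E) + h * G| ≤
      1 * (B * B) * F + 2 * (a * B * F) + B * F := by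
    have := abs_le.1 (hpp hp hp); have := abs_le.1 (haE hp); have := abs_le.1 (hyG hh)
    rw [abs_le]; constructor <;> linarith
  have e2 : |s * (p * q) * G + k * G - a * q * E| ≤ 1 * (B * B) * F + B * F + a * B * F := by
    have := abs_le.1 (hpp hp hq); have := abs_le.1 (haE hq); have := abs_le.1 (hyG hk)
    rw [abs_le]; constructor <;> linarith
  have e3 : |s * (q * q) * G - h * G| ≤ 1 * (B * B) * F + B * F := by
    have := abs_le.1 (hpp hq hq); have := abs_le.1 (hyG hh)
    rw [abs_le]; constructor <;> linarith
  have f1 := abs_le.1 (abs_mul_le_mul h0 e1)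
  have f2 := abs_le.1 (abs_mul_le_mul h1 e2)
  have f3 := abs_le.1 (abs_mul_le_mul h2 e3)
  have f4 := abs_le.1 (abs_mul_le_mul hb0 (hyG hp))
  have f5 := abs_le.1 (abs_mul_le_mul hb1 (hyG hq))
  rw [abs_le]
  constructor <;> nlinarith

/-! ### Bounds on the coefficients and strict supersolutions -/

/-- The pointwise consequences of uniform ellipticity that the comparison argument uses. -/
structure EllipticBounds (Ω : Set Plane) (A : Plane → Matrix (Fin 2) (Fin 2) ℝ)
    (c M : ℝ) : Prop where
  symm : ∀ x ∈ Ω, A x 1 0 = A x 0 1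
  lower : ∀ x ∈ Ω, c ≤ A x 0 0
  det_nonneg : ∀ x ∈ Ω, 0 ≤ A x 0 0 * A x 1 1 - A x 0 1 ^ 2
  bound₀₀ : ∀ x ∈ Ω, |A x 0 0| ≤ M
  bound₀₁ : ∀ x ∈ Ω, |A x 0 1| ≤ M
  bound₁₁ : ∀ x ∈ Ω, |A x 1 1| ≤ M

theorem UniformlyElliptic.exists_bounds {Ω : Set Plane} {A : Plane → Matrix (Fin 2) (Fin 2) ℝ}
    (hA : UniformlyElliptic Ω A) : ∃ c M : ℝ, 0 < c ∧ EllipticBounds Ω A c M := by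
  obtain ⟨hsymm, ⟨c, hc, hell⟩, M, hM, htr⟩ := hA
  have hs : ∀ x ∈ Ω, A x 1 0 = A x 0 1 := fun x hx => (hsymm x hx).apply 0 1
  have hq : ∀ x ∈ Ω, ∀ p q : ℝ, c * (p ^ 2 + q ^ 2) ≤
      p ^ 2 * A x 0 0 + 2 * (p * q * A x 0 1) + q ^ 2 * A x 1 1 := by
    intro x hx p q
    have h := hell x hx !₂[p, q]
    rw [EuclideanSpace.norm_eq, Real.sq_sqrt (by positivity)] at h
    simp [Fin.sum_univ_two, hs x hx] at h
    linarith
  have h0 : ∀ x ∈ Ω, c ≤ A x 0 0 := fun x hx => by linarith [hq x hx 1 0]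
  have h1 : ∀ x ∈ Ω, c ≤ A x 1 1 := fun x hx => by linarith [hq x hx 0 1]
  have ht : ∀ x ∈ Ω, A x 0 0 + A x 1 1 ≤ M := fun x hx => by
    simpa [Matrix.trace, Fin.sum_univ_two] using htr x hx
  refine ⟨c, M, hc, hs, h0, ?_, ?_, ?_, ?_⟩ <;> intro x hx
  -- The quadratic form at `(-a₀₁, a₀₀)` equals `a₀₀ det A`.
  · have h := hq x hx (-A x 0 1) (A x 0 0)
    have hpos : 0 < A x 0 0 := hc.trans_le (h0 x hx)
    have : 0 ≤ A x 0 0 * (A x 0 0 * A x 1 1 - A x 0 1 ^ 2) := by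
      have : 0 ≤ c * ((-A x 0 1) ^ 2 + A x 0 0 ^ 2) := by positivity
      nlinarith
    exact nonneg_of_mul_nonneg_right this hpos
  · rw [abs_le]; constructor <;> linarith [h0 x hx, h1 x hx, ht x hx]
  · rw [abs_le]
    constructor <;> linarith [h0 x hx, h1 x hx, ht x hx, hq x hx 1 1, hq x hx 1 (-1)]
  · rw [abs_le]; constructor <;> linarith [h0 x hx, h1 x hx, ht x hx]

theorem abs_two_mul_mul_le_of_sq_add_sq_le {x y r : ℝ} (h : x ^ 2 + y ^ 2 ≤ r) :
    |2 * x * y| ≤ 2 * r :=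
  abs_le.2 ⟨by nlinarith [sq_nonneg (x + y)], by nlinarith [sq_nonneg (x - y)]⟩

theorem abs_sq_sub_sq_le_of_sq_add_sq_le {x y r : ℝ} (h : x ^ 2 + y ^ 2 ≤ r) :
    |y ^ 2 - x ^ 2| ≤ 2 * r :=
  abs_le.2 ⟨by linarith [sq_nonneg x, sq_nonneg y], by linarith [sq_nonneg x, sq_nonneg y]⟩

/-- In a bounded region away from the origin, `e^{s θ} (K - e^{a x₀})` is a strict supersolution
for all small `s` of either sign. -/
theorem exists_strict_barrier {Ω : Set Plane} {A : Plane → Matrix (Fin 2) (Fin 2) ℝ}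
    {b : Plane → Plane} {c M N ρ R : ℝ} (hc : 0 < c) (hA : EllipticBounds Ω A c M)
    (hb : ∀ x ∈ Ω, ‖b x‖ ≤ N) (hN : 0 ≤ N) (hρ : 0 < ρ) (hR : 0 ≤ R)
    (hΩ : ∀ x ∈ Ω, ρ ≤ ‖x‖ ∧ ‖x‖ ≤ R) :
    ∃ a K g₁ g₂ ν : ℝ, 0 < g₁ ∧ 0 < g₂ ∧ 0 < ν ∧
      (∀ x : Plane, ‖x‖ ≤ R → g₁ ≤ K - Real.exp (a * x 0) ∧ K - Real.exp (a * x 0) ≤ g₂) ∧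
      ∀ s, |s| ≤ ν → ∀ x ∈ Ω, ∀ t, x ∈ angleHalfPlane t →
        0 < ellipticOp A b (barrier a K s t) x := by
  -- This choice gives `a a₀₀ - b₀ ≥ 1`, so the term at `s = 0` is at least `a e^{a x₀}`.
  set a := (N + 1) / c with ha
  have ha0 : 0 < a := by positivity
  -- `F` serves as `K`: twice the maximum of `e^{a x₀}` keeps `K - e^{a x₀}` between `e^{aR}` and
  -- `F`.
  set F := 2 * Real.exp (a * R) with hF
  -- A common bound for the first and second derivatives of the angle when `ρ ≤ |x| ≤ R`.
  set B := max (R / ρ ^ 2) (2 * R ^ 2 / (ρ ^ 2) ^ 2) with hB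
  set Q := |M| * (4 * B ^ 2 * F + 4 * a * B * F + 4 * B * F) + 2 * N * B * F with hQ
  have hB0 : 0 ≤ B := le_max_of_le_left (by positivity)
  have hF0 : 0 < F := by positivity
  have hQ0 : 0 ≤ Q := by positivity
  set e := Real.exp (-(a * R)) with he
  have he0 : 0 < e := Real.exp_pos _
  clear_value a F B Q e
  have hcoord : ∀ (x : Plane) (i : Fin 2), |x i| ≤ ‖x‖ := fun x i => by
    simpa using PiLp.norm_apply_le x i
  have hE : ∀ x : Plane, ‖x‖ ≤ R → e ≤ Real.exp (a * x 0) ∧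
      Real.exp (a * x 0) ≤ Real.exp (a * R) := by
    intro x hx
    have := abs_le.1 ((hcoord x 0).trans hx)
    constructor
    · rw [he, ← mul_neg]; gcongr; exact this.1
    · gcongr; exact this.2
  -- The value of `ν` makes `s` times the remainder, at most `νQ`, smaller than the main term, at
  -- least `e a`. The minimum with 1 is what the remainder bound requires.
  refine ⟨a, F, Real.exp (a * R), F, min 1 (e * a / (2 * (Q + 1))), Real.exp_pos _,
    hF0, by positivity, ?_, ?_⟩
  · intro x hx
    have := hE x hx
    have := Real.exp_pos (a * x 0)
    constructor <;> linarith
  intro s hs x hx t hxt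
  have hs1 : |s| ≤ 1 := hs.trans (min_le_left _ _)
  have hs2 : |s| ≤ e * a / (2 * (Q + 1)) := hs.trans (min_le_right _ _)
  obtain ⟨hx1, hx2⟩ := hΩ x hx
  have hn : x 0 ^ 2 + x 1 ^ 2 = ‖x‖ ^ 2 := by
    rw [EuclideanSpace.norm_eq, Real.sq_sqrt (by positivity)]
    simp [Fin.sum_univ_two]
  have hρn : ρ ^ 2 ≤ x 0 ^ 2 + x 1 ^ 2 := by rw [hn]; gcongr
  have hNpos : 0 < x 0 ^ 2 + x 1 ^ 2 := (by positivity : 0 < ρ ^ 2).trans_le hρn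
  have hx0 : |x 0| ≤ R := (hcoord x 0).trans hx2
  have hx1' : |x 1| ≤ R := (hcoord x 1).trans hx2
  have hq1 : ∀ {y : ℝ}, |y| ≤ R → |y / (x 0 ^ 2 + x 1 ^ 2)| ≤ B := by
    intro y hy
    rw [hB]
    rw [abs_div, abs_of_pos hNpos]
    exact (by gcongr : _ ≤ R / ρ ^ 2).trans (le_max_left _ _)
  have hq2 : ∀ {y : ℝ}, |y| ≤ 2 * R ^ 2 → |y / (x 0 ^ 2 + x 1 ^ 2) ^ 2| ≤ B := by
    intro y hy
    rw [hB]
    rw [abs_div, abs_of_pos (pow_pos hNpos 2)]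
    exact (by gcongr : _ ≤ 2 * R ^ 2 / (ρ ^ 2) ^ 2).trans (le_max_right _ _)
  have hnR : x 0 ^ 2 + x 1 ^ 2 ≤ R ^ 2 := by rw [hn]; gcongr
  have hEx := hE x hx2
  have hEpos := Real.exp_pos (a * x 0)
  rw [ellipticOp_barrier a F s hxt (hA.symm x hx) rfl rfl rfl rfl rfl rfl]
  refine mul_pos (Real.exp_pos _) ?_
  have hrem := abs_barrier_remainder_le (a₀ := A x 0 0) (a₁ := A x 0 1) (a₂ := A x 1 1)
    (b₀ := b x 0) (b₁ := b x 1) (s := s) (p := -x 1 / (x 0 ^ 2 + x 1 ^ 2))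
    (q := x 0 / (x 0 ^ 2 + x 1 ^ 2)) (h := 2 * x 0 * x 1 / (x 0 ^ 2 + x 1 ^ 2) ^ 2)
    (k := (x 1 ^ 2 - x 0 ^ 2) / (x 0 ^ 2 + x 1 ^ 2) ^ 2) (E := Real.exp (a * x 0))
    (G := F - Real.exp (a * x 0)) (a := a) (M := |M|) (N := N) (B := B) (F := F)
    ((hA.bound₀₀ x hx).trans (le_abs_self M)) ((hA.bound₀₁ x hx).trans (le_abs_self M))
    ((hA.bound₁₁ x hx).trans (le_abs_self M))
    ((hcoord _ 0).trans (hb x hx)) ((hcoord _ 1).trans (hb x hx)) hs1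
    (hq1 (by rwa [abs_neg])) (hq1 hx0)
    (hq2 (abs_two_mul_mul_le_of_sq_add_sq_le hnR)) (hq2 (abs_sq_sub_sq_le_of_sq_add_sq_le hnR))
    (by rw [abs_of_pos hEpos]; linarith)
    (by rw [abs_of_nonneg (by linarith)]; linarith) ha0.le
  have hsr := (le_abs_self _).trans (abs_mul_le_mul hs2 hrem)
  have hlt : e * a / (2 * (Q + 1)) * Q < e * a := by
    rw [div_mul_eq_mul_div, div_lt_iff₀ (by positivity)]
    have h1 : 0 < e * a := by positivity
    have h2 := mul_nonneg h1.le hQ0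
    linarith
  have hb0 := (abs_le.1 ((hcoord _ 0).trans (hb x hx))).2
  have hmain : e * a ≤ a * Real.exp (a * x 0) * (a * A x 0 0 - b x 0) := by
    have h1 : 1 ≤ a * A x 0 0 - b x 0 := by
      have : a * c = N + 1 := by rw [ha]; field_simp
      linarith [mul_le_mul_of_nonneg_left (hA.lower x hx) ha0.le]
    have h2 : a * e ≤ a * Real.exp (a * x 0) := by gcongr; exact hEx.1
    have h3 : 0 ≤ a * Real.exp (a * x 0) := by positivity
    linarith [le_mul_of_one_le_right h3 h1]
  rw [← hQ] at hsr
  linarith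

namespace WindingDomain

variable (D : WindingDomain)

/-! ### Geometry of the channel -/

theorem exists_radius_bounds : ∃ ρ R : ℝ, 0 < ρ ∧ 0 ≤ R ∧
    ∀ θ, D.θ₀ ≤ θ → ρ ≤ D.r₁ θ ∧ D.r₂ θ ≤ R := by
  have h1 : ∀ᶠ θ in atTop, D.rStar / 2 < D.r₁ θ :=
    D.tendsto_r₁.eventually_const_lt (half_lt_self D.rStar_pos)
  have h2 : ∀ᶠ θ in atTop, D.r₂ θ < D.rStar + 1 :=
    D.tendsto_r₂.eventually_lt_const (lt_add_one _)
  obtain ⟨T, hT⟩ := eventually_atTop.1 (h1.and h2)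
  have hne : (Icc D.θ₀ (max T D.θ₀)).Nonempty := nonempty_Icc.2 (le_max_right _ _)
  obtain ⟨s, hs, hs'⟩ := isCompact_Icc.exists_isMinOn hne
    (D.continuousOn_r₁.mono fun _ h => h.1)
  obtain ⟨q, hq, hq'⟩ := isCompact_Icc.exists_isMaxOn hne
    (D.continuousOn_r₂.mono fun _ h => h.1)
  refine ⟨min (D.r₁ s) (D.rStar / 2), max (D.r₂ q) (D.rStar + 1),
    lt_min (D.r₁_pos s hs.1) (half_pos D.rStar_pos),
    le_max_of_le_left (D.r₂_pos q hq.1).le, fun θ hθ => ?_⟩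
  by_cases h : θ ≤ max T D.θ₀
  · exact ⟨min_le_of_left_le (hs' ⟨hθ, h⟩), le_max_of_le_left (hq' ⟨hθ, h⟩)⟩
  · have := hT θ ((le_max_left _ _).trans (not_le.1 h).le)
    exact ⟨min_le_of_right_le this.1.le, le_max_of_le_right this.2.le⟩

theorem continuous_polarX : Continuous fun p : ℝ × ℝ => polarX p.1 p.2 := by
  unfold polarX
  refine (PiLp.continuous_toLp 2 _).comp (continuous_pi fun i => ?_)
  fin_cases i <;> simp <;> fun_prop

/-- A function that is continuous on the closed channel in polar coordinates attains its maximum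
over the part `θ ≤ T`. -/
theorem exists_max_le {v : ℝ → ℝ → ℝ} {T : ℝ} (hT : D.θ₀ ≤ T)
    (hv : ContinuousOn (fun p : ℝ × ℝ => v p.1 p.2)
      {p | D.θ₀ ≤ p.2 ∧ D.r₁ p.2 ≤ p.1 ∧ p.1 ≤ D.r₂ p.2}) :
    ∃ r θ, D.θ₀ ≤ θ ∧ θ ≤ T ∧ D.r₁ θ ≤ r ∧ r ≤ D.r₂ θ ∧
      ∀ r' θ', D.θ₀ ≤ θ' → θ' ≤ T → D.r₁ θ' ≤ r' → r' ≤ D.r₂ θ' → v r' θ' ≤ v r θ := by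
  set K : Set (ℝ × ℝ) := Icc 0 1 ×ˢ Icc D.θ₀ T
  have hK : IsCompact K := isCompact_Icc.prod isCompact_Icc
  -- Linear interpolation between the radii parametrizes the region `θ ≤ T` by a rectangle, which
  -- supplies compactness.
  set φ : ℝ × ℝ → ℝ × ℝ := fun p => ((1 - p.1) * D.r₁ p.2 + p.1 * D.r₂ p.2, p.2)
  have hr : ∀ {r : ℝ → ℝ}, ContinuousOn r (Ici D.θ₀) → ContinuousOn (fun p : ℝ × ℝ => r p.2) K :=
    fun h => h.comp continuousOn_snd fun p hp => hp.2.1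
  have hφ : ContinuousOn φ K := by
    have := hr D.continuousOn_r₁
    have := hr D.continuousOn_r₂
    fun_prop
  have hmaps : MapsTo φ K {p | D.θ₀ ≤ p.2 ∧ D.r₁ p.2 ≤ p.1 ∧ p.1 ≤ D.r₂ p.2} := by
    rintro ⟨l, θ⟩ ⟨⟨h0, h1⟩, h2, h3⟩
    have := D.r₁_lt_r₂ θ h2
    refine ⟨h2, ?_, ?_⟩ <;> simp only [φ] at * <;> nlinarith
  obtain ⟨⟨l, θ⟩, hp, hmax⟩ := hK.exists_isMaxOn
    ⟨(0, D.θ₀), ⟨by simp, by simp [hT]⟩⟩ (hv.comp hφ hmaps)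
  have hm := hmaps hp
  refine ⟨(φ (l, θ)).1, θ, hp.2.1, hp.2.2, hm.2.1, hm.2.2, fun r' θ' h1 h2 h3 h4 => ?_⟩
  have hlt := D.r₁_lt_r₂ θ' h1
  have hd : 0 < D.r₂ θ' - D.r₁ θ' := by linarith
  have hmem : ((r' - D.r₁ θ') / (D.r₂ θ' - D.r₁ θ'), θ') ∈ K :=
    ⟨⟨div_nonneg (by linarith) hd.le, (div_le_one hd).2 (by linarith)⟩, h1, h2⟩
  have := hmax hmem
  have e : φ ((r' - D.r₁ θ') / (D.r₂ θ' - D.r₁ θ'), θ') = (r', θ') := by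
    simp only [φ, Prod.mk.injEq, and_true]
    field_simp
    ring
  simp only [mem_ofPred_eq, Function.comp_apply, e] at this
  exact this

/-- Near an interior point of the channel, `(‖x‖, angleNear θ x)` are polar coordinates in the
interior of the channel. -/
theorem eventually_polar_mem {r θ T : ℝ} (hθ : D.θ₀ < θ) (hT : θ < T) (h1 : D.r₁ θ < r)
    (h2 : r < D.r₂ θ) : ∀ᶠ x in 𝓝 (polarX r θ), x ∈ angleHalfPlane θ ∧
      D.θ₀ < angleNear θ x ∧ angleNear θ x < T ∧ D.r₁ (angleNear θ x) < ‖x‖ ∧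
      ‖x‖ < D.r₂ (angleNear θ x) := by
  have hr : 0 < r := (D.r₁_pos θ hθ.le).trans h1
  have hmem := polarX_mem_angleHalfPlane hr θ
  have ha : ContinuousAt (angleNear θ) (polarX r θ) := (contDiffAt_angleNear hmem).continuousAt
  have hn : Tendsto (fun x : Plane => ‖x‖) (𝓝 (polarX r θ)) (𝓝 r) := by
    simpa [norm_polarX hr.le] using (continuous_norm (E := Plane)).tendsto (polarX r θ)
  have ht : Tendsto (angleNear θ) (𝓝 (polarX r θ)) (𝓝 θ) := by
    simpa [ContinuousAt, angleNear_polarX] using ha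
  have c1 := (D.continuousOn_r₁.continuousAt (Ici_mem_nhds hθ)).tendsto.comp ht
  have c2 := (D.continuousOn_r₂.continuousAt (Ici_mem_nhds hθ)).tendsto.comp ht
  filter_upwards [(isOpen_angleHalfPlane θ).mem_nhds hmem, ht.eventually_const_lt hθ,
    ht.eventually_lt_const hT, c1.eventually_lt hn h1, hn.eventually_lt c2 h2]
    with x a1 a2 a3 a4 a5 using ⟨a1, a2, a3, a4, a5⟩

theorem U_mem_nhds {r θ : ℝ} (hθ : D.θ₀ < θ) (h1 : D.r₁ θ < r) (h2 : r < D.r₂ θ) :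
    D.U ∈ 𝓝 (polarX r θ) := by
  filter_upwards [D.eventually_polar_mem hθ (lt_add_one θ) h1 h2] with x hx
  exact ⟨‖x‖, angleNear θ x, hx.2.1, hx.2.2.2.1, hx.2.2.2.2, (polarX_norm_angleNear hx.1).symm⟩

theorem crossSection_subset {θ : ℝ} (hθ : D.θ₀ ≤ θ) : D.crossSection θ ⊆ D.Utilde := by
  rintro x ⟨r, h1, h2, rfl⟩
  exact ⟨r, θ, hθ, h1, h2, rfl⟩

theorem le_crossMax {f : Plane → ℝ} (hf : ContinuousOn f D.Utilde) {θ : ℝ} (hθ : D.θ₀ ≤ θ)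
    {x : Plane} (hx : x ∈ D.crossSection θ) : f x ≤ D.crossMax f θ :=
  (D.isGreatest_crossMax hf hθ).2 ⟨x, hx, rfl⟩

theorem crossMax_le {f : Plane → ℝ} {θ c : ℝ} (hθ : D.θ₀ ≤ θ)
    (h : ∀ x ∈ D.crossSection θ, f x ≤ c) : D.crossMax f θ ≤ c := by
  refine csSup_le ⟨_, mem_image_of_mem f ⟨D.r₁ θ, le_rfl, (D.r₁_lt_r₂ θ hθ).le, rfl⟩⟩ ?_
  rintro _ ⟨x, hx, rfl⟩
  exact h x hx

/-! ### Comparison -/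

section Comparison

variable {D} {A : Plane → Matrix (Fin 2) (Fin 2) ℝ} {b : Plane → Plane} {c M a K g ν : ℝ}
  {u : Plane → ℝ}

/-- If the inequality failed, `u - W` would have a positive maximum over a truncated channel. The
initial data, the lateral data and the growing term exclude the boundary, and strictness of the
barrier with coefficient `δ` excludes the interior. -/
theorem le_add_growing_barrier (hc : 0 < c) (hA : EllipticBounds D.U A c M) (hg : 0 < g)
    (hν : 0 < ν) (hG : ∀ x ∈ D.Utilde, g ≤ K - Real.exp (a * x 0))
    (hL : ∀ s, |s| ≤ ν → ∀ x ∈ D.U, ∀ t, x ∈ angleHalfPlane t →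
      0 < ellipticOp A b (barrier a K s t) x)
    (hu : ContDiffOn ℝ 2 u D.U) (huc : ContinuousOn u D.Utilde) (hgrowth : D.BelowExpGrowth u)
    (hsub : ∀ x ∈ D.U, ellipticOp A b u x ≤ 0) (hlat : ∀ x ∈ D.lateral, u x ≤ 0)
    {m κ δ : ℝ} (hm : 0 ≤ m) (hκ : 0 ≤ κ) (hδ : 0 < δ)
    (hinit : ∀ x ∈ D.crossSection D.θ₀,
      u x ≤ m + κ * (Real.exp (-ν * D.θ₀) * (K - Real.exp (a * x 0))))
    {r θ : ℝ} (hθ : D.θ₀ ≤ θ) (h1 : D.r₁ θ ≤ r) (h2 : r ≤ D.r₂ θ) :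
    u (polarX r θ) ≤ m + κ * (Real.exp (-ν * θ) * (K - Real.exp (a * polarX r θ 0)))
      + δ * (Real.exp (ν * θ) * (K - Real.exp (a * polarX r θ 0))) := by
  -- `W` takes the angle as a separate argument, so no global branch is needed.
  set W : ℝ → Plane → ℝ := fun θ x => m + κ * (Real.exp (-ν * θ) * (K - Real.exp (a * x 0)))
      + δ * (Real.exp (ν * θ) * (K - Real.exp (a * x 0))) with hW
  set v : ℝ → ℝ → ℝ := fun r θ => u (polarX r θ) - W θ (polarX r θ) with hv
  by_contra! hcon
  have hpos : 0 < v r θ := by simp only [hv, hW]; linarith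
  have hmem : ∀ {r θ : ℝ}, D.θ₀ ≤ θ → D.r₁ θ ≤ r → r ≤ D.r₂ θ → polarX r θ ∈ D.Utilde :=
    fun h h' h'' => ⟨_, _, h, h', h'', rfl⟩
  -- Growth below `e^{νθ}` is what is needed: beyond `T₀`, `|u|` is less than `δ g e^{νθ}`, a lower
  -- bound for the growing term.
  obtain ⟨T₀, hT₀⟩ := eventually_atTop.1
    ((hgrowth ν hν).eventually_lt_const (show 0 < δ * g by positivity))
  set T := max T₀ θ
  have hθT : θ ≤ T := le_max_right _ _
  have hfar : ∀ r, D.r₁ T ≤ r → r ≤ D.r₂ T → v r T ≤ 0 := by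
    intro r h1 h2
    have hT : D.θ₀ ≤ T := hθ.trans (le_max_right _ _)
    have hx := hG _ (hmem hT h1 h2)
    have hle : u (polarX r T) ≤ D.crossMax (fun x => |u x|) T :=
      (le_abs_self _).trans (D.le_crossMax (f := fun x => |u x|) huc.abs hT ⟨r, h1, h2, rfl⟩)
    have hlt := hT₀ T (le_max_left _ _)
    have hexp : Real.exp (ν * T) * Real.exp (-ν * T) = 1 := by
      rw [← Real.exp_add]; simp
    have h3 : D.crossMax (fun x => |u x|) T ≤ δ * (Real.exp (ν * T) * g) := by
      have := mul_le_mul_of_nonneg_left hlt.le (Real.exp_pos (ν * T)).le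
      rw [← mul_assoc, hexp] at this
      linarith
    have h4 : δ * (Real.exp (ν * T) * g) ≤
        δ * (Real.exp (ν * T) * (K - Real.exp (a * polarX r T 0))) := by gcongr
    have h5 : 0 ≤ κ * (Real.exp (-ν * T) * (K - Real.exp (a * polarX r T 0))) := by
      have := hg.le.trans hx
      positivity
    simp only [hv, hW]
    linarith
  have hcont : ContinuousOn (fun p : ℝ × ℝ => v p.1 p.2)
      {p | D.θ₀ ≤ p.2 ∧ D.r₁ p.2 ≤ p.1 ∧ p.1 ≤ D.r₂ p.2} := by
    have hu' : ContinuousOn (fun p : ℝ × ℝ => u (polarX p.1 p.2))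
        {p | D.θ₀ ≤ p.2 ∧ D.r₁ p.2 ≤ p.1 ∧ p.1 ≤ D.r₂ p.2} :=
      huc.comp continuous_polarX.continuousOn fun p hp => hmem hp.1 hp.2.1 hp.2.2
    have hp : Continuous fun p : ℝ × ℝ => polarX p.1 p.2 0 := by
      simp only [polarX]
      simp
      fun_prop
    refine hu'.sub (Continuous.continuousOn ?_)
    simp only [hW]
    fun_prop
  obtain ⟨q, η, hη, hηT, hq1, hq2, hmax⟩ := D.exists_max_le (hθ.trans hθT) hcont
  have hvpos : 0 < v q η := hpos.trans_le (hmax r θ hθ hθT h1 h2)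
  have hGpos : 0 < K - Real.exp (a * polarX q η 0) := hg.trans_le (hG _ (hmem hη hq1 hq2))
  have hWpos : 0 ≤ W η (polarX q η) := by simp only [hW]; positivity
  have hη0 : D.θ₀ < η := by
    refine lt_of_le_of_ne hη fun h => ?_
    subst h
    have := hinit _ ⟨q, hq1, hq2, rfl⟩
    have : 0 ≤ δ * (Real.exp (ν * D.θ₀) * (K - Real.exp (a * polarX q D.θ₀ 0))) := by positivity
    simp only [hv, hW] at hvpos
    linarith
  have hηT' : η < T := by
    refine lt_of_le_of_ne hηT fun h => ?_
    rw [h] at hvpos hq1 hq2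
    exact (hfar q hq1 hq2).not_gt hvpos
  have hq1' : D.r₁ η < q := by
    refine lt_of_le_of_ne hq1 fun h => ?_
    have := hlat (polarX q η) ⟨η, hη, Or.inl (by rw [h])⟩
    simp only [hv] at hvpos
    linarith
  have hq2' : q < D.r₂ η := by
    refine lt_of_le_of_ne hq2 fun h => ?_
    have := hlat (polarX q η) ⟨η, hη, Or.inr (by rw [h])⟩
    simp only [hv] at hvpos
    linarith
  set x := polarX q η with hx
  have hxU : x ∈ D.U := ⟨q, η, hη0, hq1', hq2', rfl⟩
  have hxa : x ∈ angleHalfPlane η := polarX_mem_angleHalfPlane ((D.r₁_pos η hη).trans hq1') η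
  have hux : ContDiffAt ℝ 2 u x := hu.contDiffAt (D.U_mem_nhds hη0 hq1' hq2')
  have hb1 := contDiffAt_barrier a K (-ν) hxa
  have hb2 := contDiffAt_barrier a K ν hxa
  have hs1 : ContDiffAt ℝ 2 ((-κ) • barrier a K (-ν) η) x := contDiffAt_const.smul hb1
  have hs2 : ContDiffAt ℝ 2 ((-δ) • barrier a K ν η) x := contDiffAt_const.smul hb2
  have hsm : ContDiffAt ℝ 2 (fun _ : Plane => -m) x := contDiffAt_const
  have hc1 : ContDiffAt ℝ 2 (u + fun _ => -m) x := hux.add hsm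
  have hc2 : ContDiffAt ℝ 2 ((u + fun _ => -m) + (-κ) • barrier a K (-ν) η) x := hc1.add hs1
  -- Near the maximum point, `z` is `u - W` with the angle given by the branch around `η`, hence a
  -- `C²` function of the plane variable alone.
  set z : Plane → ℝ := ((u + fun _ => -m) + (-κ) • barrier a K (-ν) η) + (-δ) • barrier a K ν η
    with hz
  have hc3 : ContDiffAt ℝ 2 z x := hc2.add hs2
  have hlocal : IsLocalMax z x := by
    have e : ∀ y, z y = u y - W (angleNear η y) y := by
      intro y
      simp only [hz, Pi.add_apply, Pi.smul_apply, smul_eq_mul, barrier, hW]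
      ring
    filter_upwards [D.eventually_polar_mem hη0 hηT' hq1' hq2'] with y hy
    rw [e, e]
    have := hmax ‖y‖ (angleNear η y) hy.2.1.le hy.2.2.1.le hy.2.2.2.1.le hy.2.2.2.2.le
    simpa only [hv, polarX_norm_angleNear hy.1, hx, angleNear_polarX] using this
  have hop := ellipticOp_nonneg_of_isLocalMax (A := A) (b := b) hc3 hlocal (hA.symm x hxU)
    (hc.trans_le (hA.lower x hxU)) (hA.det_nonneg x hxU)
  rw [hz, ellipticOp_add hc2 hs2, ellipticOp_add hc1 hs1, ellipticOp_add hux hsm,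
    ellipticOp_const, ellipticOp_const_smul, ellipticOp_const_smul] at hop
  have p1 := hL (-ν) (by rw [abs_neg, abs_of_pos hν]) x hxU η hxa
  have p2 := hL ν (by rw [abs_of_pos hν]) x hxU η hxa
  have := hsub x hxU
  have := mul_nonneg hκ p1.le
  have := mul_pos hδ p2
  linarith

/-- At a fixed point the growing term is `δ` times a fixed positive number, so it can be made equal
to any `ε > 0`. -/
theorem le_add_decaying_barrier (hc : 0 < c) (hA : EllipticBounds D.U A c M) (hg : 0 < g)
    (hν : 0 < ν) (hG : ∀ x ∈ D.Utilde, g ≤ K - Real.exp (a * x 0))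
    (hL : ∀ s, |s| ≤ ν → ∀ x ∈ D.U, ∀ t, x ∈ angleHalfPlane t →
      0 < ellipticOp A b (barrier a K s t) x)
    (hu : ContDiffOn ℝ 2 u D.U) (huc : ContinuousOn u D.Utilde) (hgrowth : D.BelowExpGrowth u)
    (hsub : ∀ x ∈ D.U, ellipticOp A b u x ≤ 0) (hlat : ∀ x ∈ D.lateral, u x ≤ 0)
    {m κ : ℝ} (hm : 0 ≤ m) (hκ : 0 ≤ κ)
    (hinit : ∀ x ∈ D.crossSection D.θ₀,
      u x ≤ m + κ * (Real.exp (-ν * D.θ₀) * (K - Real.exp (a * x 0))))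
    {r θ : ℝ} (hθ : D.θ₀ ≤ θ) (h1 : D.r₁ θ ≤ r) (h2 : r ≤ D.r₂ θ) :
    u (polarX r θ) ≤ m + κ * (Real.exp (-ν * θ) * (K - Real.exp (a * polarX r θ 0))) := by
  have hpos : 0 < Real.exp (ν * θ) * (K - Real.exp (a * polarX r θ 0)) :=
    mul_pos (Real.exp_pos _) (hg.trans_le (hG _ ⟨r, θ, hθ, h1, h2, rfl⟩))
  refine le_of_forall_pos_le_add fun ε hε => ?_
  have := le_add_growing_barrier hc hA hg hν hG hL hu huc hgrowth hsub hlat hm hκ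
    (div_pos hε hpos) hinit hθ h1 h2
  rwa [div_mul_cancel₀ _ hpos.ne'] at this

end Comparison

/-- The maximum principle and exponential decay for subsolutions. -/
theorem exists_decay {A : Plane → Matrix (Fin 2) (Fin 2) ℝ} {b : Plane → Plane}
    (hA : UniformlyElliptic D.U A) (hb : BoundedDrift D.U b) :
    ∃ C ν : ℝ, 0 < C ∧ 0 < ν ∧ ∀ u : Plane → ℝ, ContDiffOn ℝ 2 u D.U →
      ContinuousOn u D.Utilde → D.BelowExpGrowth u → (∀ x ∈ D.U, ellipticOp A b u x ≤ 0) →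
      (∀ x ∈ D.lateral, u x ≤ 0) → ∀ m : ℝ, 0 ≤ m → (∀ x ∈ D.crossSection D.θ₀, u x ≤ m) →
      ∀ θ, D.θ₀ ≤ θ → ∀ x ∈ D.crossSection θ,
        u x ≤ m ∧ u x ≤ C * m * Real.exp (-ν * (θ - D.θ₀)) := by
  obtain ⟨c, M, hc, hA⟩ := hA.exists_bounds
  obtain ⟨N, hN, hb⟩ := hb
  obtain ⟨ρ, R, hρ, hR, hrad⟩ := D.exists_radius_bounds
  have hnorm : ∀ x ∈ D.Utilde, ρ ≤ ‖x‖ ∧ ‖x‖ ≤ R := by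
    rintro x ⟨r, θ, hθ, h1, h2, rfl⟩
    rw [norm_polarX ((D.r₁_pos θ hθ).le.trans h1)]
    exact ⟨(hrad θ hθ).1.trans h1, h2.trans (hrad θ hθ).2⟩
  have hsub : D.U ⊆ D.Utilde := by
    rintro x ⟨r, θ, hθ, h1, h2, rfl⟩
    exact ⟨r, θ, hθ.le, h1.le, h2.le, rfl⟩
  obtain ⟨a, K, g₁, g₂, ν, hg₁, hg₂, hν, hG, hL⟩ :=
    exists_strict_barrier hc hA hb hN hρ hR fun x hx => hnorm x (hsub hx)
  have hG' : ∀ x ∈ D.Utilde, g₁ ≤ K - Real.exp (a * x 0) := fun x hx => (hG x (hnorm x hx).2).1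
  refine ⟨g₂ / g₁, ν, by positivity, hν, ?_⟩
  rintro u hu huc hgrowth hLu hlat m hm hinit θ hθ _ ⟨r, h1, h2, rfl⟩
  constructor
  -- Taking `κ = 0` leaves the constant `m` alone, which is the maximum principle.
  · simpa using le_add_decaying_barrier hc hA hg₁ hν hG' hL hu huc hgrowth hLu hlat hm le_rfl
      (by simpa using hinit) hθ h1 h2
  · have hexp : Real.exp (ν * D.θ₀) * Real.exp (-ν * D.θ₀) = 1 := by rw [← Real.exp_add]; simp
    -- Now the constant part is zero, and `κ` is chosen so that the lower bound `g₁` of `K - e^{a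
    -- x₀}` already puts the barrier above `m` on the initial section. The upper bound `g₂` then
    -- produces `C = g₂ / g₁`.
    have := le_add_decaying_barrier (κ := m * Real.exp (ν * D.θ₀) / g₁) hc hA hg₁ hν hG' hL hu huc
      hgrowth hLu hlat le_rfl (by positivity) (fun x hx => ?_) hθ h1 h2
    · refine this.trans ?_
      rw [zero_add]
      have hx := (hG _ (hnorm _ ⟨r, θ, hθ, h1, h2, rfl⟩).2).2
      calc m * Real.exp (ν * D.θ₀) / g₁ *
            (Real.exp (-ν * θ) * (K - Real.exp (a * polarX r θ 0)))
          ≤ m * Real.exp (ν * D.θ₀) / g₁ * (Real.exp (-ν * θ) * g₂) := by gcongr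
        _ = g₂ / g₁ * m * Real.exp (-ν * (θ - D.θ₀)) := by
          rw [show -ν * (θ - D.θ₀) = ν * D.θ₀ + -ν * θ by ring, Real.exp_add]
          ring
    · have hx' := hG' x (D.crossSection_subset le_rfl hx)
      calc u x ≤ m := hinit x hx
        _ = m * (Real.exp (ν * D.θ₀) * Real.exp (-ν * D.θ₀)) * g₁ / g₁ := by
          rw [hexp]; field_simp
        _ ≤ m * (Real.exp (ν * D.θ₀) * Real.exp (-ν * D.θ₀)) * (K - Real.exp (a * x 0)) / g₁ := by
          gcongr
        _ = _ := by ring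

end WindingDomain
end

noncomputable section

namespace WindingDomain

variable (D : WindingDomain)

/-! ### From subsolutions to positive parts and absolute values -/

/-- The level `m` is the initial maximum of `u⁺` or of `|u|`. For solutions the one-sided estimate
is applied to `u` and to `-u`. -/
theorem exists_decay_posPart {A : Plane → Matrix (Fin 2) (Fin 2) ℝ} {b : Plane → Plane}
    (hA : UniformlyElliptic D.U A) (hb : BoundedDrift D.U b) :
    ∃ C ν : ℝ, 0 < C ∧ 0 < ν ∧ ∀ u : Plane → ℝ, ContDiffOn ℝ 2 u D.U →
      ContinuousOn u D.Utilde → D.BelowExpGrowth u →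
      ((∀ x ∈ D.U, ellipticOp A b u x ≤ 0) → (∀ x ∈ D.lateral, u x ≤ 0) →
        ∀ θ, D.θ₀ ≤ θ → ∀ x ∈ D.crossSection θ,
          max (u x) 0 ≤ D.crossMax (fun y => max (u y) 0) D.θ₀ ∧
          max (u x) 0 ≤ C * D.crossMax (fun y => max (u y) 0) D.θ₀ *
            Real.exp (-ν * (θ - D.θ₀))) ∧
      ((∀ x ∈ D.U, ellipticOp A b u x = 0) → (∀ x ∈ D.lateral, u x = 0) →
        ∀ θ, D.θ₀ ≤ θ → ∀ x ∈ D.crossSection θ,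
          |u x| ≤ D.crossMax (fun y => |u y|) D.θ₀ ∧
          |u x| ≤ C * D.crossMax (fun y => |u y|) D.θ₀ * Real.exp (-ν * (θ - D.θ₀))) := by
  obtain ⟨C, ν, hC, hν, h⟩ := D.exists_decay hA hb
  refine ⟨C, ν, hC, hν, fun u hu huc hg => ⟨fun hL hlat θ hθ x hx => ?_,
    fun hL hlat θ hθ x hx => ?_⟩⟩
  · have hle : ∀ y ∈ D.crossSection D.θ₀, max (u y) 0 ≤ D.crossMax (fun y => max (u y) 0) D.θ₀ :=
      fun y hy => D.le_crossMax (f := fun y => max (u y) 0) (huc.sup continuousOn_const) le_rfl hy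
    have hm : 0 ≤ D.crossMax (fun y => max (u y) 0) D.θ₀ := (le_max_right _ _).trans
      (hle _ ⟨D.r₁ D.θ₀, le_rfl, (D.r₁_lt_r₂ _ le_rfl).le, rfl⟩)
    obtain ⟨h1, h2⟩ := h u hu huc hg hL hlat _ hm
      (fun y hy => (le_max_left _ _).trans (hle y hy)) θ hθ x hx
    exact ⟨max_le h1 hm, max_le h2 (by positivity)⟩
  · have hle : ∀ y ∈ D.crossSection D.θ₀, |u y| ≤ D.crossMax (fun y => |u y|) D.θ₀ :=
      fun y hy => D.le_crossMax (f := fun y => |u y|) huc.abs le_rfl hy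
    have hm : 0 ≤ D.crossMax (fun y => |u y|) D.θ₀ := (abs_nonneg _).trans
      (hle _ ⟨D.r₁ D.θ₀, le_rfl, (D.r₁_lt_r₂ _ le_rfl).le, rfl⟩)
    have hneg : D.BelowExpGrowth (-u) := by simpa [BelowExpGrowth] using hg
    have hop : ∀ y, ellipticOp A b (-u) y = -ellipticOp A b u y := fun y => by
      simpa using ellipticOp_const_smul A b (-1) u y
    obtain ⟨h1, h2⟩ := h u hu huc hg (fun y hy => (hL y hy).le) (fun y hy => (hlat y hy).le) _ hm
      (fun y hy => (le_abs_self _).trans (hle y hy)) θ hθ x hx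
    obtain ⟨h3, h4⟩ := h (-u) hu.neg huc.neg hneg (fun y hy => by rw [hop, hL y hy, neg_zero])
      (fun y hy => by simp [hlat y hy]) _ hm
      (fun y hy => (neg_le_abs _).trans (hle y hy)) θ hθ x hx
    exact ⟨abs_le'.2 ⟨h1, h3⟩, abs_le'.2 ⟨h2, h4⟩⟩

/-! ### Growth of the arc-length -/

theorem hasDerivAt_polarX_one (η : ℝ) :
    HasDerivAt (polarX 1) (polarX 1 (η + Real.pi / 2)) η := by
  have e : ∀ p q : ℝ, (!₂[p, q] : Plane) =
      p • EuclideanSpace.single 0 1 + q • EuclideanSpace.single 1 1 := by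
    intro p q
    ext i
    fin_cases i <;> simp
  have h : polarX 1 = fun t => Real.cos t • (EuclideanSpace.single 0 1 : Plane) +
      Real.sin t • (EuclideanSpace.single 1 1 : Plane) := by
    ext1 t
    simp only [polarX, one_mul, e]
  rw [h]
  have h2 := ((Real.hasDerivAt_cos η).smul_const (EuclideanSpace.single 0 1 : Plane)).fun_add
    ((Real.hasDerivAt_sin η).smul_const (EuclideanSpace.single 1 1 : Plane))
  simpa [Real.cos_add_pi_div_two, Real.sin_add_pi_div_two] using h2

theorem polarX_eq_smul (r θ : ℝ) : polarX r θ = r • polarX 1 θ := by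
  ext i
  fin_cases i <;> simp [polarX]

/-- The velocity splits into a radial part, a convex combination of the derivatives of the radii,
and an angular part whose length is the interpolated radius. The resulting bound is free of `λ`. -/
theorem norm_deriv_midCurve_le {R l η : ℝ} (hl : l ∈ Icc (0 : ℝ) 1) (hη : D.θ₀ ≤ η)
    (hR : D.r₂ η ≤ R) (h1 : DifferentiableAt ℝ D.r₁ η) (h2 : DifferentiableAt ℝ D.r₂ η) :
    ‖deriv (D.midCurve l) η‖ ≤ |deriv D.r₁ η| + |deriv D.r₂ η| + R := by
  have hρ := (h1.hasDerivAt.const_mul (1 - l)).fun_add (h2.hasDerivAt.const_mul l)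
  have hX := hρ.smul (hasDerivAt_polarX_one η)
  have e : D.midCurve l = (fun t => (1 - l) * D.r₁ t + l * D.r₂ t) • polarX 1 := by
    ext1 t
    exact polarX_eq_smul _ _
  rw [e, hX.deriv]
  refine (norm_add_le _ _).trans ?_
  rw [norm_smul, norm_smul, norm_polarX zero_le_one, norm_polarX zero_le_one, Real.norm_eq_abs,
    Real.norm_eq_abs]
  have hlt := D.r₁_lt_r₂ η hη
  have hpos := D.r₁_pos η hη
  have a1 : |(1 - l) * D.r₁ η + l * D.r₂ η| ≤ R := by
    rw [abs_le]; constructor <;> nlinarith [hl.1, hl.2]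
  have a2 : |(1 - l) * deriv D.r₁ η + l * deriv D.r₂ η| ≤ |deriv D.r₁ η| + |deriv D.r₂ η| := by
    refine (abs_add_le _ _).trans ?_
    rw [abs_mul, abs_mul, abs_of_nonneg hl.1, abs_of_nonneg (sub_nonneg.2 hl.2)]
    nlinarith [hl.1, hl.2, abs_nonneg (deriv D.r₁ η), abs_nonneg (deriv D.r₂ η)]
  linarith

/-- The total variation of a locally absolutely continuous function with eventually bounded
derivative grows at most linearly. -/
theorem integral_abs_deriv_le_linear {f : ℝ → ℝ} {a Θ : ℝ}
    (hf : ∀ T, a ≤ T → AbsolutelyContinuousOnInterval f a T) (hΘ : a ≤ Θ)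
    (hb : MemLp (deriv f) ⊤ (volume.restrict (Ioi Θ))) :
    ∃ k B : ℝ, 0 ≤ k ∧ 0 ≤ B ∧ ∀ θ, a ≤ θ → ∫ η in a..θ, |deriv f η| ≤ k + B * (θ - a) := by
  have hint : ∀ T, a ≤ T → IntervalIntegrable (fun η => |deriv f η|) volume a T :=
    fun T hT => (hf T hT).intervalIntegrable_deriv.abs
  set B := (eLpNorm (deriv f) ⊤ (volume.restrict (Ioi Θ))).toReal
  have hB : ∀ᵐ η ∂volume.restrict (Ioi Θ), |deriv f η| ≤ B := by
    filter_upwards [ae_le_eLpNormEssSup (f := deriv f) (μ := volume.restrict (Ioi Θ))] with η hη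
    rw [← eLpNorm_exponent_top] at hη
    have := ENNReal.toReal_mono hb.eLpNorm_ne_top hη
    simpa [B] using this
  -- The constant `k` absorbs the variation up to `Θ`, where the derivative need not be bounded; `B`
  -- is the essential bound beyond `Θ`.
  refine ⟨∫ η in a..Θ, |deriv f η|, B,
    intervalIntegral.integral_nonneg hΘ fun _ _ => abs_nonneg _, ENNReal.toReal_nonneg,
    fun θ hθ => ?_⟩
  -- Enlarging the interval to reach at least `Θ` treats `θ < Θ` and `θ ≥ Θ` together.
  set S := max θ Θ
  have hS : a ≤ S := hθ.trans (le_max_left _ _)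
  have hΘS : Θ ≤ S := le_max_right _ _
  have h1 : ∫ η in a..θ, |deriv f η| ≤ ∫ η in a..S, |deriv f η| :=
    intervalIntegral.integral_mono_interval le_rfl hθ (le_max_left _ _)
      (ae_of_all _ fun _ => abs_nonneg _) (hint S hS)
  have hΘS' : IntervalIntegrable (fun η => |deriv f η|) volume Θ S :=
    (hint Θ hΘ).symm.trans (hint S hS)
  have h2 : ∫ η in Θ..S, |deriv f η| ≤ B * (S - Θ) := by
    have : ∫ η in Θ..S, |deriv f η| ≤ ∫ _ in Θ..S, B := by
      rw [intervalIntegral.integral_of_le hΘS, intervalIntegral.integral_of_le hΘS]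
      refine integral_mono_of_nonneg (ae_of_all _ fun _ => abs_nonneg _) (by simp) ?_
      exact ae_mono (Measure.restrict_mono Ioc_subset_Ioi_self le_rfl) hB
    refine this.trans_eq ?_
    simp [mul_comm]
  have h3 : S - Θ ≤ θ - a := by
    rcases max_cases θ Θ with ⟨h, _⟩ | ⟨h, _⟩ <;> simp only [S, h] <;> linarith
  have h4 : B * (S - Θ) ≤ B * (θ - a) := mul_le_mul_of_nonneg_left h3 ENNReal.toReal_nonneg
  have h5 := intervalIntegral.integral_add_adjacent_intervals (hint Θ hΘ) hΘS'
  linarith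

theorem exists_arcLength_le (h : D.RegularRadii) : ∃ k B : ℝ, 0 ≤ k ∧ 0 < B ∧
    ∀ l ∈ Icc (0 : ℝ) 1, ∀ θ, D.θ₀ ≤ θ → D.arcLength l θ ≤ k + B * (θ - D.θ₀) := by
  obtain ⟨hac, Θ, hΘ, hb1, hb2⟩ := h
  obtain ⟨ρ, R, hρ, hR, hrad⟩ := D.exists_radius_bounds
  obtain ⟨k₁, B₁, hk₁, hB₁, h1⟩ := integral_abs_deriv_le_linear (fun T hT => (hac T hT).1) hΘ hb1
  obtain ⟨k₂, B₂, hk₂, hB₂, h2⟩ := integral_abs_deriv_le_linear (fun T hT => (hac T hT).2) hΘ hb2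
  -- The summand 1 only makes the slope strictly positive, since it later appears as a divisor.
  refine ⟨k₁ + k₂, B₁ + B₂ + R + 1, by positivity, by positivity, fun l hl θ hθ => ?_⟩
  obtain ⟨ac1, ac2⟩ := hac θ hθ
  have i1 := ac1.intervalIntegrable_deriv.abs
  have i2 := ac2.intervalIntegrable_deriv.abs
  have hle : D.arcLength l θ ≤ ∫ η in D.θ₀..θ, (|deriv D.r₁ η| + |deriv D.r₂ η| + R) := by
    have hi := (i1.add i2).add (intervalIntegrable_const (c := R))
    rw [intervalIntegrable_iff_integrableOn_Ioc_of_le hθ] at hi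
    unfold arcLength
    rw [intervalIntegral.integral_of_le hθ, intervalIntegral.integral_of_le hθ]
    refine integral_mono_of_nonneg (ae_of_all _ fun _ => norm_nonneg _) hi ?_
    rw [EventuallyLE, ae_restrict_iff' measurableSet_Ioc]
    filter_upwards [ac1.ae_differentiableAt, ac2.ae_differentiableAt] with η e1 e2 hη
    have hm : η ∈ uIcc D.θ₀ θ := by rw [uIcc_of_le hθ]; exact ⟨hη.1.le, hη.2⟩
    exact D.norm_deriv_midCurve_le hl hη.1.le (hrad η hη.1.le).2 (e1 hm) (e2 hm)
  rw [intervalIntegral.integral_add (i1.add i2) intervalIntegrable_const,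
    intervalIntegral.integral_add i1 i2, intervalIntegral.integral_const, smul_eq_mul] at hle
  have := h1 θ hθ
  have := h2 θ hθ
  linarith

theorem exists_arcDist_le (h : D.RegularRadii) : ∃ k B : ℝ, 0 ≤ k ∧ 0 < B ∧
    ∀ θ, D.θ₀ ≤ θ → ∀ x ∈ D.crossSection θ, D.arcDist x ≤ k + B * (θ - D.θ₀) := by
  obtain ⟨k, B, hk, hB, hle⟩ := D.exists_arcLength_le h
  refine ⟨k, B, hk, hB, ?_⟩
  rintro θ hθ _ ⟨r, h1, h2, rfl⟩
  have hd : 0 < D.r₂ θ - D.r₁ θ := sub_pos.2 (D.r₁_lt_r₂ θ hθ)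
  have hl : (r - D.r₁ θ) / (D.r₂ θ - D.r₁ θ) ∈ Icc (0 : ℝ) 1 :=
    ⟨div_nonneg (by linarith) hd.le, (div_le_one hd).2 (by linarith)⟩
  have e : polarX r θ = D.midCurve ((r - D.r₁ θ) / (D.r₂ θ - D.r₁ θ)) θ := by
    unfold midCurve
    congr 1
    field_simp
    ring
  rw [e, D.arcDist_midCurve hl hθ]
  exact hle _ hl θ hθ

end WindingDomain
end

/-! ### Decay in the angle and in the arc-distance -/

theorem corollary4p4 (D : WindingDomain)
    (A : Plane → Matrix (Fin 2) (Fin 2) ℝ) (b : Plane → Plane)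
    (hA : UniformlyElliptic D.U A) (hb : BoundedDrift D.U b) :
    -- decay in terms of the angle
    (∃ C : ℝ, 0 < C ∧ ∃ ν : ℝ, 0 < ν ∧ ∀ u : Plane → ℝ,
      ContDiffOn ℝ 2 u D.U → ContinuousOn u D.Utilde → D.BelowExpGrowth u →
      -- subsolutions
      ((∀ x ∈ D.U, ellipticOp A b u x ≤ 0) → (∀ x ∈ D.lateral, u x ≤ 0) →
        (∀ x ∈ D.Utilde, max (u x) 0 ≤ D.crossMax (fun y => max (u y) 0) D.θ₀) ∧
        (∀ θ, D.θ₀ ≤ θ → D.crossMax (fun y => max (u y) 0) θ ≤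
          C * D.crossMax (fun y => max (u y) 0) D.θ₀ * Real.exp (-ν * (θ - D.θ₀)))) ∧
      -- solutions
      ((∀ x ∈ D.U, ellipticOp A b u x = 0) → (∀ x ∈ D.lateral, u x = 0) →
        (∀ x ∈ D.Utilde, |u x| ≤ D.crossMax (fun y => |u y|) D.θ₀) ∧
        (∀ θ, D.θ₀ ≤ θ → D.crossMax (fun y => |u y|) θ ≤
          C * D.crossMax (fun y => |u y|) D.θ₀ * Real.exp (-ν * (θ - D.θ₀))))) ∧
    -- decay in terms of the arc-distance
    (D.RegularRadii → ∃ C' : ℝ, 0 < C' ∧ ∃ ν' : ℝ, 0 < ν' ∧ ∀ u : Plane → ℝ,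
      ContDiffOn ℝ 2 u D.U → ContinuousOn u D.Utilde → D.BelowExpGrowth u →
      -- subsolutions
      ((∀ x ∈ D.U, ellipticOp A b u x ≤ 0) → (∀ x ∈ D.lateral, u x ≤ 0) →
        (∀ x ∈ D.Utilde, max (u x) 0 ≤ D.crossMax (fun y => max (u y) 0) D.θ₀) ∧
        (∀ x ∈ D.Utilde, max (u x) 0 ≤
          C' * D.crossMax (fun y => max (u y) 0) D.θ₀ * Real.exp (-ν' * D.arcDist x))) ∧
      -- solutions
      ((∀ x ∈ D.U, ellipticOp A b u x = 0) → (∀ x ∈ D.lateral, u x = 0) →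
        (∀ x ∈ D.Utilde, |u x| ≤ D.crossMax (fun y => |u y|) D.θ₀) ∧
        (∀ x ∈ D.Utilde, |u x| ≤
          C' * D.crossMax (fun y => |u y|) D.θ₀ * Real.exp (-ν' * D.arcDist x)))) := by
  obtain ⟨C, ν, hC, hν, hdecay⟩ := D.exists_decay_posPart hA hb
  have hUt : ∀ x ∈ D.Utilde, ∃ θ, D.θ₀ ≤ θ ∧ x ∈ D.crossSection θ := by
    rintro x ⟨r, θ, hθ, h1, h2, rfl⟩
    exact ⟨θ, hθ, r, h1, h2, rfl⟩
  refine ⟨⟨C, hC, ν, hν, fun u hu huc hg => ⟨fun hL hlat => ?_, fun hL hlat => ?_⟩⟩, fun hreg => ?_⟩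
  · have h := (hdecay u hu huc hg).1 hL hlat
    refine ⟨fun x hx => ?_, fun θ hθ => D.crossMax_le hθ fun x hx => (h θ hθ x hx).2⟩
    obtain ⟨θ, hθ, hx⟩ := hUt x hx
    exact (h θ hθ x hx).1
  · have h := (hdecay u hu huc hg).2 hL hlat
    refine ⟨fun x hx => ?_, fun θ hθ => D.crossMax_le hθ fun x hx => (h θ hθ x hx).2⟩
    obtain ⟨θ, hθ, hx⟩ := hUt x hx
    exact (h θ hθ x hx).1
  · obtain ⟨k, B, hk, hB, harc⟩ := D.exists_arcDist_le hreg
    -- From `ℒ ≤ k + B(θ - θ₀)`, decay at rate `ν` in the angle becomes decay at rate `ν / B` in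
    -- `ℒ`, at the price of the factor `e^{νk/B}`.
    have hconv : ∀ {v m θ : ℝ} {x : Plane}, 0 ≤ v → v ≤ m → D.θ₀ ≤ θ → x ∈ D.crossSection θ →
        v ≤ C * m * Real.exp (-ν * (θ - D.θ₀)) →
        v ≤ C * Real.exp (ν / B * k) * m * Real.exp (-(ν / B) * D.arcDist x) := by
      intro v m θ x hv hvm hθ hx h
      have hm : 0 ≤ m := hv.trans hvm
      have he : -ν * (θ - D.θ₀) ≤ ν / B * k + -(ν / B) * D.arcDist x := by
        have h1 := mul_le_mul_of_nonneg_left (harc θ hθ x hx) (div_pos hν hB).le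
        have h2 : ν / B * (k + B * (θ - D.θ₀)) = ν / B * k + ν * (θ - D.θ₀) := by field_simp
        linarith
      calc v ≤ C * m * Real.exp (-ν * (θ - D.θ₀)) := h
        _ ≤ C * m * Real.exp (ν / B * k + -(ν / B) * D.arcDist x) := by gcongr
        _ = _ := by rw [Real.exp_add]; ring
    refine ⟨C * Real.exp (ν / B * k), by positivity, ν / B, by positivity, fun u hu huc hg =>
      ⟨fun hL hlat => ?_, fun hL hlat => ?_⟩⟩
    · have h := (hdecay u hu huc hg).1 hL hlat
      refine ⟨fun x hx => ?_, fun x hx => ?_⟩ <;> obtain ⟨θ, hθ, hx⟩ := hUt x hx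
      · exact (h θ hθ x hx).1
      · exact hconv (le_max_right _ _) (h θ hθ x hx).1 hθ hx (h θ hθ x hx).2
    · have h := (hdecay u hu huc hg).2 hL hlat
      refine ⟨fun x hx => ?_, fun x hx => ?_⟩ <;> obtain ⟨θ, hθ, hx⟩ := hUt x hx
      · exact (h θ hθ x hx).1
      · exact hconv (abs_nonneg _) (h θ hθ x hx).1 hθ hx (h θ hθ x hx).2
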